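/- Let $T\ge 0$, let $(\Omega,\mathcal G,\mathbb P)$ be a complete probability space and let $\mathbf F=(\mathcal F_t)_{t\in[0,T]}$ be a right-continuous filtration with $\mathcal F_t\subseteq\mathcal G$, such that $\mathcal F_0$ contains all $\mathbb P$-null sets and $\mathbb P[A]\in\{0,1\}$ for all $A\in\mathcal F_0$. A stochastic process is a family $X=(X_t)_{t\in[0,T]}$ of $\mathcal G$-measurable real random variables (not necessarily $\mathbf F$-adapted); random variables are identified when they are a.s. equal. $X$ is nonnegative (strictly positive) if for every $t$ one has $X_t\ge0$ ($X_t>0$) a.s. A nonnegative process is càd in probability if $t\mapsto X_t$ is right-continuous for convergence in probability, and càdlàg in probability if moreover at every $t\in(0,T]$ it has a left limit in probability, which is a finite nonnegative random variable. A nonnegative process $Z$ is a generalized supermartingale if $\mathbb E[Z_t/Z_s\mid\mathcal F_s]\le 1$ a.s. for all $0\le s\le t\le T$, where $Z_t/Z_s=\infty$ on $\{Z_s=0,Z_t>0\}$ and $Z_t/Z_s=1$ on $\{Z_s=0=Z_t\}$. Let $\mathcal X$ be a set of stochastic processes such that: (a) each $X\in\mathcal X$ is nonnegative and càd in probability, and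 $X_0=1$; (b) $\mathcal X$ contains a strictly positive process; (c) $(1-\alpha)X+\alpha X'\in\mathcal X$ for all $X,X'\in\mathcal X$ and $\alpha\in[0,1]$; (d) for all $\tau\in[0,T]$, $A\in\mathcal F_\tau$, $X\in\mathcal X$ and strictly positive $X'\in\mathcal X$, the process equal to $X_t(\omega)$ if $t<\tau$ or $\omega\notin A$, and to $(X_\tau(\omega)/X'_\tau(\omega))\,X'_t(\omega)$ if $t\ge\tau$ and $\omega\in A$, belongs to $\mathcal X$. Consider the conditions: (1) $\{X_T: X\in\mathcal X\}$ is bounded in probability: $\lim_{\ell\to\infty}\sup_{X\in\mathcal X}\mathbb P[X_T>\ell]=0$; (2) there is a strictly positive process $Y$, càdlàg in probability, such that $YX$ is a generalized supermartingale for every $X\in\mathcal X$; (2') there is a strictly positive process $Y$, càd in probability, such that $YX$ is a generalized supermartingale for every $X\in\mathcal X$; (3) there is a strictly positive $\widehat X\in\mathcal X$ such that $X/\widehat X$ is a generalized supermartingale for every $X\in\mathcal X$. Then the following hold. (i) Suppose that the strictly positive process in (b) can be chosen so that at every $t\in(0,T]$ it has a left limit in probability which is a.s. strictly positive (for instance,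 $1\in\mathcal X$). Then (1) and (2) are equivalent; under either of them every $X\in\mathcal X$ is càdlàg in probability; and if moreover $\{X_T:X\in\mathcal X\}$ is closed in probability, then (1), (2) and (3) are equivalent. (ii) Without the additional condition on left limits in (i), (1) and (2') are equivalent; and if $\{X_T:X\in\mathcal X\}$ is closed in probability, then (1) and (3) are equivalent. -/

import Mathlib

open MeasureTheory ProbabilityTheory Filter Topology Set
open scoped ENNReal

namespace LimitedInfo

variable {Ω : Type*} {m : MeasurableSpace Ω} {T : ℝ}

/-- A (not necessarily adapted) family of real functions on `Ω` indexed by the time interval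
`[0, T]`. Measurability is part of `IsNonneg` below. -/
abbrev StochProc (T : ℝ) (Ω : Type*) : Type _ := Icc (0 : ℝ) T → Ω → ℝ

/-- `X` is a nonnegative stochastic process: every `X t` is a random variable that is almost surely
nonnegative. -/
def IsNonneg (P : Measure Ω) (X : StochProc T Ω) : Prop :=
  ∀ t, Measurable (X t) ∧ ∀ᵐ ω ∂P, 0 ≤ X t ω

/-- `X` is a strictly positive stochastic process: every `X t` is a random variable that is almost
surely strictly positive. -/
def IsStrictlyPos (P : Measure Ω) (X : StochProc T Ω) : Prop :=
  ∀ t, Measurable (X t) ∧ ∀ᵐ ω ∂P, 0 < X t ω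

/-- `X` is right-continuous for convergence in probability. -/
def IsCadInProb (P : Measure Ω) (X : StochProc T Ω) : Prop :=
  ∀ t, TendstoInMeasure P X (𝓝[>] t) (X t)

/-- `X` is right-continuous for convergence in probability and has a left-hand limit, again a
(finite) nonnegative random variable, at every time `t > 0`. -/
def IsCadlagInProb (P : Measure Ω) (X : StochProc T Ω) : Prop :=
  IsCadInProb P X ∧
    ∀ t : Icc (0 : ℝ) T, 0 < (t : ℝ) →
      ∃ L : Ω → ℝ, Measurable L ∧ (∀ᵐ ω ∂P, 0 ≤ L ω) ∧ TendstoInMeasure P X (𝓝[<] t) L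

/-- At every time `t > 0`, `X` has a left-hand limit in probability that is an almost surely
strictly positive random variable. -/
def HasPosLeftLimits (P : Measure Ω) (X : StochProc T Ω) : Prop :=
  ∀ t : Icc (0 : ℝ) T, 0 < (t : ℝ) →
    ∃ L : Ω → ℝ, Measurable L ∧ (∀ᵐ ω ∂P, 0 < L ω) ∧ TendstoInMeasure P X (𝓝[<] t) L

open Classical in
/-- The ratio `b / a` of nonnegative reals with the conventions `b / 0 = ∞` for `b ≠ 0` and
`0 / 0 = 1`. -/
noncomputable def extRatio (b a : ℝ) : ℝ≥0∞ :=
  if a = 0 then (if b = 0 then 1 else ⊤) else ENNReal.ofReal (b / a)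

/-- `Z` is a generalized supermartingale with respect to `ℱ`: it is a nonnegative process and
`E[Z_t / Z_s | ℱ_s] ≤ 1` almost surely for all `s ≤ t`. The conditional expectation is that of a
`[0, ∞]`-valued random variable. -/
def IsGenSupermartingale (P : Measure Ω) (ℱ : Filtration (Icc (0 : ℝ) T) m) (Z : StochProc T Ω) :
    Prop :=
  IsNonneg P Z ∧
    ∀ s t, s ≤ t → ∀ᵐ ω ∂P, condLExp (ℱ s) P (fun ω => extRatio (Z t ω) (Z s ω)) ω ≤ 1

/-- `Z` belongs to `𝒳`, up to modification: random variables are identified when they are almost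
surely equal. -/
def MemUpToModification (P : Measure Ω) (𝒳 : Set (StochProc T Ω)) (Z : StochProc T Ω) : Prop :=
  ∃ X ∈ 𝒳, ∀ t, X t =ᵐ[P] Z t

open Classical in
/-- The process that follows `X` and, at time `τ` on the event `A`, switches to `X'`. -/
noncomputable def switch (τ : Icc (0 : ℝ) T) (A : Set Ω) (X X' : StochProc T Ω) : StochProc T Ω :=
  fun t ω => if t < τ ∨ ω ∉ A then X t ω else X τ ω / X' τ ω * X' t ω

/-- Convexity of a set of processes. -/
def IsConvex (P : Measure Ω) (𝒳 : Set (StochProc T Ω)) : Prop :=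
  ∀ X ∈ 𝒳, ∀ X' ∈ 𝒳, ∀ α ∈ Icc (0 : ℝ) 1,
    MemUpToModification P 𝒳 (fun t ω => (1 - α) * X t ω + α * X' t ω)

/-- The switching property of a set of processes with respect to `ℱ`. -/
def HasSwitching (P : Measure Ω) (ℱ : Filtration (Icc (0 : ℝ) T) m) (𝒳 : Set (StochProc T Ω)) :
    Prop :=
  ∀ (τ : Icc (0 : ℝ) T) (A : Set Ω), MeasurableSet[ℱ τ] A →
    ∀ X ∈ 𝒳, ∀ X' ∈ 𝒳, IsStrictlyPos P X' → MemUpToModification P 𝒳 (switch τ A X X')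

/-- Boundedness in probability of a set of nonnegative random variables. -/
def IsBoundedInProb (P : Measure Ω) (S : Set (Ω → ℝ)) : Prop :=
  Tendsto (fun ℓ : ℝ => ⨆ f ∈ S, P {ω | ℓ < f ω}) atTop (𝓝 0)

/-- Closedness of a set of random variables for convergence in probability (which is metrizable,
so that sequences suffice), random variables being identified when almost surely equal. -/
def IsClosedInProb (P : Measure Ω) (S : Set (Ω → ℝ)) : Prop :=
  ∀ f : ℕ → Ω → ℝ, (∀ n, f n ∈ S) → ∀ g : Ω → ℝ, Measurable g →
    TendstoInMeasure P f atTop g → ∃ h ∈ S, h =ᵐ[P] g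

/-- The set of values at time `t` of the processes in `𝒳`. -/
def valuesAt (𝒳 : Set (StochProc T Ω)) (t : Icc (0 : ℝ) T) : Set (Ω → ℝ) :=
  (fun X => X t) '' 𝒳

/-- `Y` is a generalized supermartingale deflator for `𝒳`: it is strictly positive and `Y X` is a
generalized supermartingale for all `X ∈ 𝒳`. -/
def IsDeflator (P : Measure Ω) (ℱ : Filtration (Icc (0 : ℝ) T) m) (𝒳 : Set (StochProc T Ω))
    (Y : StochProc T Ω) : Prop :=
  IsStrictlyPos P Y ∧ ∀ X ∈ 𝒳, IsGenSupermartingale P ℱ (fun t ω => Y t ω * X t ω)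

/-- `Xhat` is a numéraire in `𝒳`: it is a strictly positive element of `𝒳` and `X / Xhat` is a
generalized supermartingale for all `X ∈ 𝒳`. -/
def IsNumeraire (P : Measure Ω) (ℱ : Filtration (Icc (0 : ℝ) T) m) (𝒳 : Set (StochProc T Ω))
    (Xhat : StochProc T Ω) : Prop :=
  Xhat ∈ 𝒳 ∧ IsStrictlyPos P Xhat ∧
    ∀ X ∈ 𝒳, IsGenSupermartingale P ℱ (fun t ω => X t ω / Xhat t ω)

end LimitedInfo

/-! The numéraire is the log-optimal element. Fix a strictly positive `Xbar` in the class and nearly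
maximise the expectation of a bounded concave substitute for the logarithm, evaluated at `X_T /
Xbar_T`, over strictly positive `X`. The first-order inequality along convex combinations says that
`E[V_T / X_T]` is almost at most one, for a truncated ratio (`exists_integral_approxRatio_le`).
Since near maximisers suffice, neither compactness nor closedness is used here.

Switching transports this terminal inequality to any time: following `X₁` until `t` and then moving
in proportion to `X₂` gives the terminal ratio `R = X₁_t / X₂_t` against `X₂`. Two near maximisers
thus make the truncated means of `R` and `1 / R` almost at most one, on an event of large
probability furnished by boundedness in probability. As `R + 1 / R` exceeds two away from `R = 1`,
the two are close, uniformly in `t` (`exists_measureReal_log_sub_ge_le`). Their logarithms therefore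
converge uniformly in time to some `L`, which inherits right-continuity. Switching at `s` on an
event `A` of `ℱ s`, and back at `t`, localises the inequality; Fatou then makes `Y = exp (-L)` a
deflator (`IsNumeraireLimit.isDeflator`).

Conversely, a deflator gives `E[Y_T X_T / Y_0] ≤ 1`, and Markov's inequality yields boundedness. If
terminal values are closed, `exp (L_T)` is the terminal value of some `U` in the class; `Y U` starts
and ends at one, and `x + 1 / x ≥ 2` again forces `Y U = 1` at all times, so `U` is a numéraire.

Left limits come from an oscillation bound (`exists_log_leftLimit`): if the ratios of `Z` have mean
at most one, each oscillation of `log Z` lowers it by a definite amount on average, which cannot go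
on indefinitely while `Z` keeps a positive value at the later time. This is applied to `Y Xbar`, and
then to `Y (X + Xbar) / 2`. -/

namespace LimitedInfo

/-! ### Convergence in probability along countably generated filters. -/

section ConvergenceInMeasure

variable {Ω ι : Type*} {m : MeasurableSpace Ω} {P : Measure Ω}

/-- Subsequence criterion for convergence in measure along a countably generated filter. -/
theorem tendstoInMeasure_of_subseq [IsProbabilityMeasure P] {l : Filter ι} [l.IsCountablyGenerated] {f : ι → Ω → ℝ}
    {g : Ω → ℝ} (hf : ∀ i, AEMeasurable (f i) P)
    (h : ∀ ns : ℕ → ι, Tendsto ns atTop l → ∃ ms : ℕ → ℕ,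
      ∀ᵐ ω ∂P, Tendsto (fun k => f (ns (ms k)) ω) atTop (𝓝 (g ω))) :
    TendstoInMeasure P f l g := by
  intro ε hε
  refine tendsto_of_subseq_tendsto fun ns hns => ?_
  obtain ⟨ms, hms⟩ := h ns hns
  exact ⟨ms, tendstoInMeasure_of_tendsto_ae (fun n => (hf _).aestronglyMeasurable) hms ε hε⟩

/-- Two sequences that converge in measure converge almost everywhere along a common
subsequence. -/
theorem exists_common_subseq {f g : ℕ → Ω → ℝ} {f' g' : Ω → ℝ}
    (hf : TendstoInMeasure P f atTop f') (hg : TendstoInMeasure P g atTop g') :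
    ∃ ms : ℕ → ℕ, Tendsto ms atTop atTop ∧ ∀ᵐ ω ∂P,
      Tendsto (fun k => f (ms k) ω) atTop (𝓝 (f' ω)) ∧
      Tendsto (fun k => g (ms k) ω) atTop (𝓝 (g' ω)) := by
  obtain ⟨a, ha, hfa⟩ := hf.exists_seq_tendsto_ae
  obtain ⟨b, hb, hgb⟩ := (hg.comp ha.tendsto_atTop).exists_seq_tendsto_ae
  refine ⟨a ∘ b, ha.tendsto_atTop.comp hb.tendsto_atTop, ?_⟩
  filter_upwards [hfa, hgb] with ω h1 h2
  exact ⟨h1.comp hb.tendsto_atTop, h2⟩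

/-- Continuous mapping theorem for convergence in measure, in two variables. -/
theorem TendstoInMeasure.map₂ [IsProbabilityMeasure P] {l : Filter ι} [l.IsCountablyGenerated] {f g : ι → Ω → ℝ}
    {f' g' : Ω → ℝ} {F : ℝ × ℝ → ℝ} (hF : Measurable F)
    (hfm : ∀ i, AEMeasurable (f i) P) (hgm : ∀ i, AEMeasurable (g i) P)
    (hf : TendstoInMeasure P f l f') (hg : TendstoInMeasure P g l g')
    (hc : ∀ᵐ ω ∂P, ContinuousAt F (f' ω, g' ω)) :
    TendstoInMeasure P (fun i ω => F (f i ω, g i ω)) l (fun ω => F (f' ω, g' ω)) := by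
  refine tendstoInMeasure_of_subseq (fun i => hF.comp_aemeasurable ((hfm i).prodMk (hgm i)))
    fun ns hns => ?_
  obtain ⟨ms, -, hms⟩ := exists_common_subseq (hf.comp hns) (hg.comp hns)
  refine ⟨ms, ?_⟩
  filter_upwards [hms, hc] with ω h hcω
  exact hcω.tendsto.comp (h.1.prodMk_nhds h.2)

/-- Continuous mapping theorem for convergence in measure. -/
theorem TendstoInMeasure.map₁ [IsProbabilityMeasure P] {l : Filter ι} [l.IsCountablyGenerated] {f : ι → Ω → ℝ}
    {f' : Ω → ℝ} {F : ℝ → ℝ} (hF : Measurable F)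
    (hfm : ∀ i, AEMeasurable (f i) P) (hf : TendstoInMeasure P f l f')
    (hc : ∀ᵐ ω ∂P, ContinuousAt F (f' ω)) :
    TendstoInMeasure P (fun i ω => F (f i ω)) l (fun ω => F (f' ω)) :=
  TendstoInMeasure.map₂ (F := fun p => F p.1) (hF.comp measurable_fst) hfm hfm hf hf
    (hc.mono fun _ h => ContinuousAt.comp (f := Prod.fst) h continuousAt_fst)

/-- A bound on the probability of a deviation passes to the limit in measure. -/
theorem measure_le_of_tendstoInMeasure {l : Filter ι} [l.NeBot] {f : ι → Ω → ℝ} {g h : Ω → ℝ}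
    {c : ℝ≥0∞} {κ : ℝ} (hκ : 0 < κ) (hf : TendstoInMeasure P f l g)
    (hc : ∀ᶠ i in l, P {ω | κ ≤ |h ω - f i ω|} ≤ c) :
    P {ω | 2 * κ ≤ |h ω - g ω|} ≤ c := by
  have h0 := (tendstoInMeasure_iff_norm.1 hf) κ hκ
  have h1 : Tendsto (fun i => c + P {ω | κ ≤ ‖f i ω - g ω‖}) l (𝓝 (c + 0)) :=
    tendsto_const_nhds.add h0
  rw [add_zero] at h1
  refine ge_of_tendsto h1 (hc.mono fun i hi => ?_)
  calc P {ω | 2 * κ ≤ |h ω - g ω|}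
      ≤ P ({ω | κ ≤ |h ω - f i ω|} ∪ {ω | κ ≤ ‖f i ω - g ω‖}) := by
        refine measure_mono fun ω hω => ?_
        simp only [mem_ofPred_eq, mem_union, Real.norm_eq_abs] at hω ⊢
        by_contra! hcon
        linarith [abs_sub_le (h ω) (f i ω) (g ω)]
    _ ≤ _ := (measure_union_le _ _).trans (add_le_add hi le_rfl)

/-- Completeness of the space of random variables for convergence in measure. -/
theorem exists_tendstoInMeasure_of_cauchy [IsProbabilityMeasure P] {l : Filter ι} [l.IsCountablyGenerated] [l.NeBot]
    {f : ι → Ω → ℝ} (hfm : ∀ i, AEMeasurable (f i) P)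
    (hf : ∀ κ > 0, ∀ᶠ p in l ×ˢ l, P {ω | κ ≤ |f p.1 ω - f p.2 ω|} ≤ ENNReal.ofReal κ) :
    ∃ g : Ω → ℝ, Measurable g ∧ TendstoInMeasure P f l g := by
  have hS : ∀ k : ℕ, ∃ S ∈ l, ∀ i ∈ S, ∀ j ∈ S,
      P {ω | (1 / 2 : ℝ) ^ k ≤ |f i ω - f j ω|} ≤ ENNReal.ofReal ((1 / 2) ^ k) := by
    intro k
    exact eventually_prod_self_iff.1 (hf ((1 / 2) ^ k) (by positivity))
  choose S hSl hS using hS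
  -- Membership in all earlier `S j` makes the level-`k` estimate available between any index in `S
  -- k` and every later `x j`.
  have hx : ∀ k, ∃ x, ∀ j ≤ k, x ∈ S j := fun k =>
    Filter.nonempty_of_mem ((biInter_mem (finite_Iic k)).2 fun j _ => hSl j) |>.imp
      fun x hx j hj => mem_iInter₂.1 hx j hj
  choose x hx using hx
  -- Borel–Cantelli: almost surely, consecutive differences are eventually below a geometric
  -- sequence.
  have hbc : ∀ᵐ ω ∂P, ∀ᶠ k in atTop,
      ω ∉ {ω | (1 / 2 : ℝ) ^ k ≤ |f (x k) ω - f (x (k + 1)) ω|} := by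
    refine ae_eventually_notMem (ne_top_of_le_ne_top ?_
      (ENNReal.tsum_le_tsum fun k => hS k _ (hx k k le_rfl) _ (hx (k + 1) k (by lia))))
    rw [← ENNReal.ofReal_tsum_of_nonneg (fun k => by positivity)
      (summable_geometric_of_lt_one (by norm_num) (by norm_num))]
    exact ENNReal.ofReal_ne_top
  have hlim : ∀ᵐ ω ∂P, ∃ y, Tendsto (fun k => f (x k) ω) atTop (𝓝 y) := by
    filter_upwards [hbc] with ω hω
    obtain ⟨N, hN⟩ := eventually_atTop.1 hω
    have hc : CauchySeq fun k => f (x (k + N)) ω := by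
      refine cauchySeq_of_le_geometric (1 / 2) ((1 / 2) ^ N) (by norm_num) fun k => ?_
      have := hN (k + N) (by lia)
      simp only [not_le] at this
      rw [Real.dist_eq, ← pow_add, add_comm N k, show k + 1 + N = k + N + 1 by ring]
      exact this.le
    obtain ⟨y, hy⟩ := cauchySeq_tendsto_of_complete hc
    exact ⟨y, (tendsto_add_atTop_iff_nat N).1 hy⟩
  obtain ⟨g, hg, hgl⟩ := measurable_limit_of_tendsto_metrizable_ae (fun k => hfm (x k)) hlim
  refine ⟨g, hg, ?_⟩
  have hxg : TendstoInMeasure P (fun k => f (x k)) atTop g :=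
    tendstoInMeasure_of_tendsto_ae (fun k => (hfm (x k)).aestronglyMeasurable) hgl
  have key : ∀ k : ℕ, ∀ᶠ i in l,
      P {ω | 2 * (1 / 2 : ℝ) ^ k ≤ |f i ω - g ω|} ≤ ENNReal.ofReal ((1 / 2) ^ k) := by
    intro k
    filter_upwards [hSl k] with i hi
    refine measure_le_of_tendstoInMeasure (by positivity) hxg ?_
    filter_upwards [eventually_ge_atTop k] with j hj
    exact hS k i hi _ (hx j k hj)
  rw [tendstoInMeasure_iff_norm]
  intro ε hε
  rw [ENNReal.tendsto_nhds_zero]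
  intro δ hδ
  have t1 : Tendsto (fun k : ℕ => 2 * (1 / 2 : ℝ) ^ k) atTop (𝓝 (2 * 0)) :=
    (tendsto_pow_atTop_nhds_zero_of_lt_one (by norm_num) (by norm_num)).const_mul 2
  have t2 : Tendsto (fun k : ℕ => ENNReal.ofReal ((1 / 2 : ℝ) ^ k)) atTop (𝓝 (ENNReal.ofReal 0)) :=
    (ENNReal.continuous_ofReal.tendsto 0).comp
      (tendsto_pow_atTop_nhds_zero_of_lt_one (by norm_num) (by norm_num))
  rw [mul_zero] at t1
  rw [ENNReal.ofReal_zero] at t2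
  obtain ⟨k, hk1, hk2⟩ := ((t1.eventually_le_const hε).and (t2.eventually_le_const hδ)).exists
  filter_upwards [key k] with i hi
  refine (measure_mono fun ω hω => ?_).trans (hi.trans hk2)
  exact hk1.trans hω

end ConvergenceInMeasure

/-! ### Conditional supermartingale inequalities as integral inequalities. -/

section ConditionalExpectation

variable {Ω : Type*} {m : MeasurableSpace Ω} {P : Measure Ω} [IsProbabilityMeasure P]

/-- A conditional expectation is at most one iff the corresponding integrals over the conditioning
events are. -/
theorem condLExp_le_one_iff {m' : MeasurableSpace Ω} (hm : m' ≤ m) {f : Ω → ℝ≥0∞} :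
    (∀ᵐ ω ∂P, condLExp m' P f ω ≤ 1) ↔ ∀ A, MeasurableSet[m'] A → ∫⁻ ω in A, f ω ∂P ≤ P A := by
  constructor
  · intro h A hA
    rw [← setLIntegral_condLExp hm P f hA]
    calc ∫⁻ ω in A, condLExp m' P f ω ∂P ≤ ∫⁻ _ in A, 1 ∂P :=
          lintegral_mono_ae (ae_restrict_of_ae h)
      _ = P A := by simp
  · intro h
    refine ae_of_ae_trim hm (ae_le_of_forall_setLIntegral_le_of_sigmaFinite
      (measurable_condLExp m' P f) fun A hA _ => ?_)
    rw [setLIntegral_condLExp_trim hm P f hA]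
    simpa [trim_measurableSet_eq hm hA] using h A hA

end ConditionalExpectation

/-! ### Left limits from an oscillation bound for the logarithm. -/

section LeftLimits

variable {Ω : Type*} {m : MeasurableSpace Ω} {P : Measure Ω} {T : ℝ}

theorem integrable_of_lintegral_ofReal_le_one {f : Ω → ℝ} (hf : Measurable f)
    (hf0 : ∀ᵐ ω ∂P, 0 ≤ f ω) (h : ∫⁻ ω, ENNReal.ofReal (f ω) ∂P ≤ 1) :
    Integrable f P ∧ ∫ ω, f ω ∂P ≤ 1 := by
  have hi : Integrable f P := by
    refine ⟨hf.aestronglyMeasurable, ?_⟩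
    rw [hasFiniteIntegral_iff_ofReal hf0]
    exact h.trans_lt ENNReal.one_lt_top
  refine ⟨hi, ?_⟩
  rw [integral_eq_lintegral_of_nonneg_ae hf0 hf.aestronglyMeasurable]
  exact ENNReal.toReal_le_of_le_ofReal zero_le_one (by simpa using h)

/-- With `v = log y`, squaring `1 + v / 2 ≤ exp (v / 2)` gives the claim when `v ≥ -2`; for smaller
`v` the right side still exceeds `-5 / 4`. -/
theorem log_le_sub_one_sub_sq {y κ : ℝ} (hy : 0 < y) (hκ0 : 0 ≤ κ) (hκ : κ ≤ 1)
    (h : κ ≤ |Real.log y|) : Real.log y ≤ y - 1 - κ ^ 2 / 4 := by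
  set v := Real.log y with hv
  have hyv : y = Real.exp v := (Real.exp_log hy).symm
  by_cases hv2 : -2 ≤ v
  · have h1 : v / 2 + 1 ≤ Real.exp (v / 2) := Real.add_one_le_exp _
    have h2 : y = Real.exp (v / 2) ^ 2 := by rw [hyv, ← Real.exp_nat_mul]; congr 1; push_cast; ring
    have h3 : (v / 2 + 1) ^ 2 ≤ Real.exp (v / 2) ^ 2 := by gcongr; linarith
    have h4 : κ ^ 2 ≤ v ^ 2 := by rw [← sq_abs v]; gcongr
    nlinarith
  · have : κ ^ 2 ≤ 1 := by nlinarith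
    linarith

/-- The ratios of `Z` between successive times have expectation at most one. -/
def HasRatioLeOne (P : Measure Ω) (Z : StochProc T Ω) : Prop :=
  ∀ s t, s ≤ t → ∫⁻ ω, ENNReal.ofReal (Z t ω / Z s ω) ∂P ≤ 1

theorem HasRatioLeOne.integrable {Z : StochProc T Ω} (hZ : IsStrictlyPos P Z)
    (hr : HasRatioLeOne P Z) {s t : Icc (0 : ℝ) T} (hst : s ≤ t) :
    Integrable (fun ω => Z t ω / Z s ω) P ∧ ∫ ω, Z t ω / Z s ω ∂P ≤ 1 := by
  refine integrable_of_lintegral_ofReal_le_one ((hZ t).1.div (hZ s).1) ?_ (hr s t hst)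
  filter_upwards [(hZ t).2, (hZ s).2] with ω h1 h2
  positivity

/-- A random variable that is almost surely positive is bounded below by a positive constant with
probability close to one. -/
theorem exists_measureReal_lt_le [IsProbabilityMeasure P] {f : Ω → ℝ} (hf : Measurable f)
    (hf0 : ∀ᵐ ω ∂P, 0 < f ω) {δ : ℝ} (hδ : 0 < δ) :
    ∃ c > 0, P.real {ω | f ω < c} ≤ δ := by
  have h1 : TendstoInMeasure P (fun n : ℕ => fun _ : Ω => 1 / ((n : ℝ) + 1)) atTop
      (fun _ => (0 : ℝ)) :=
    tendstoInMeasure_of_tendsto_ae (fun n => aestronglyMeasurable_const)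
      (ae_of_all _ fun ω => tendsto_one_div_add_atTop_nhds_zero_nat)
  have h2 : Tendsto (fun n : ℕ => P.real {ω | f ω < 1 / ((n : ℝ) + 1)}) atTop (𝓝 0) := by
    have hanti : Antitone fun n : ℕ => {ω | f ω < 1 / ((n : ℝ) + 1)} := by
      intro a b hab ω hω
      refine lt_of_lt_of_le (show f ω < _ from hω) ?_
      gcongr
    have h3 := tendsto_measure_iInter_atTop (μ := P)
      (fun n : ℕ => (measurableSet_lt hf measurable_const :
        MeasurableSet {ω | f ω < 1 / ((n : ℝ) + 1)}).nullMeasurableSet) hanti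
      ⟨0, measure_ne_top _ _⟩
    have h4 : P (⋂ n : ℕ, {ω | f ω < 1 / ((n : ℝ) + 1)}) = 0 := by
      refine measure_mono_null (fun ω hω => ?_) (ae_iff.1 hf0)
      rw [mem_iInter] at hω
      exact fun h => by
        obtain ⟨n, hn⟩ := exists_nat_one_div_lt h
        exact lt_asymm hn (hω n)
    rw [h4] at h3
    exact (ENNReal.tendsto_toReal_zero_iff (fun n => measure_ne_top _ _)).2 h3
  obtain ⟨n, hn⟩ := (h2.eventually_le_const hδ).exists
  exact ⟨_, by positivity, hn⟩

/-- Strict concavity of the logarithm gains `κ ^ 2 / 4` on each oscillation event, while the terms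
`ratio - 1` have nonpositive mean. A majorant `h` is tracked because the logarithm itself need not
be integrable. The integral is confined to `G`, where the caller has a lower bound on the later
value. -/
theorem exists_log_le_of_oscillation [IsProbabilityMeasure P] {Z : StochProc T Ω}
    (hZ : IsStrictlyPos P Z)
    (hr : HasRatioLeOne P Z) {u s₀ : Icc (0 : ℝ) T} (hs₀ : s₀ < u) {κ : ℝ} (hκ0 : 0 < κ)
    (hκ : κ ≤ 1)
    (hosc : ∀ s < u, ∃ a b, s ≤ a ∧ a ≤ b ∧ b < u ∧
      κ < P.real {ω | κ ≤ |Real.log (Z a ω) - Real.log (Z b ω)|})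
    {G : Set Ω} (hG : MeasurableSet G) (hPG : P.real Gᶜ ≤ κ ^ 3 / 16) (K : ℕ) :
    ∃ s, s₀ ≤ s ∧ s < u ∧ ∃ h : Ω → ℝ, Integrable h P ∧
      ∫ ω in G, h ω ∂P ≤ -(K * (κ ^ 3 / 16)) ∧
      ∀ᵐ ω ∂P, Real.log (Z s ω) - Real.log (Z s₀ ω) ≤ h ω := by
  induction K with
  | zero => exact ⟨s₀, le_rfl, hs₀, 0, integrable_zero _ _ _, by simp, by simp⟩
  | succ K ih =>
    obtain ⟨s, hs, hsu, h, hh, hhG, hle⟩ := ih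
    obtain ⟨a, b, hsa, hab, hbu, hbad⟩ := hosc s hsu
    set D : Set Ω := {ω | κ ≤ |Real.log (Z a ω) - Real.log (Z b ω)|} with hD
    have hDm : MeasurableSet D := measurableSet_le measurable_const
      (((hZ a).1.log.sub (hZ b).1.log).abs)
    obtain ⟨hx, hx1⟩ := hr.integrable hZ hsa
    obtain ⟨hy, hy1⟩ := hr.integrable hZ hab
    have hind : Integrable (D.indicator fun _ => κ ^ 2 / 4) P := (integrable_const _).indicator hDm
    have hI0 : Integrable (fun ω => Z a ω / Z s ω - 1) P := hx.sub (integrable_const 1)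
    have hI1 : Integrable (fun ω => h ω + (Z a ω / Z s ω - 1)) P := hh.add hI0
    have hI2 : Integrable (fun ω => Z b ω / Z a ω - 1) P := hy.sub (integrable_const 1)
    refine ⟨b, hs.trans (hsa.trans hab), hbu, fun ω => h ω + (Z a ω / Z s ω - 1) +
      (Z b ω / Z a ω - 1) - D.indicator (fun _ => κ ^ 2 / 4) ω, (hI1.add hI2).sub hind, ?_, ?_⟩
    · have hI3 : Integrable (fun ω => h ω + (Z a ω / Z s ω - 1) + (Z b ω / Z a ω - 1)) P :=
        hI1.add hI2
      beta_reduce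
      rw [integral_sub hI3.integrableOn hind.integrableOn,
        integral_add hI1.integrableOn hI2.integrableOn,
        integral_add hh.integrableOn hI0.integrableOn,
        integral_sub hx.integrableOn (integrable_const 1).integrableOn,
        integral_sub hy.integrableOn (integrable_const 1).integrableOn,
        integral_indicator hDm, Measure.restrict_restrict hDm]
      have e1 : ∫ ω in G, Z a ω / Z s ω ∂P ≤ 1 := (setIntegral_le_integral hx (by
        filter_upwards [(hZ a).2, (hZ s).2] with ω h1 h2
        exact (div_pos h1 h2).le)).trans hx1
      have e2 : ∫ ω in G, Z b ω / Z a ω ∂P ≤ 1 := (setIntegral_le_integral hy (by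
        filter_upwards [(hZ b).2, (hZ a).2] with ω h1 h2
        exact (div_pos h1 h2).le)).trans hy1
      have e3 : P.real G = 1 - P.real Gᶜ := by rw [probReal_compl_eq_one_sub hG]; ring
      have e4 : P.real D ≤ P.real (D ∩ G) + P.real Gᶜ := by
        refine (measureReal_mono (fun ω hω => ?_)).trans (measureReal_union_le _ _)
        by_cases hg : ω ∈ G
        exacts [Or.inl ⟨hω, hg⟩, Or.inr hg]
      simp only [integral_const, smul_eq_mul, measureReal_restrict_apply_univ, mul_one]
      have hk2 : κ ^ 2 ≤ 1 := by nlinarith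
      have hk3 : 0 < κ ^ 3 := by positivity
      -- The gain is at least `κ ^ 3 / 4 - κ ^ 5 / 64`. Restricting the two ratio terms to `G` costs
      -- at most `2 * (κ ^ 3 / 16)`, which leaves more than `κ ^ 3 / 16`.
      have e5 : (κ - κ ^ 3 / 16) * (κ ^ 2 / 4) ≤ P.real (D ∩ G) * (κ ^ 2 / 4) := by
        gcongr
        linarith
      push_cast
      nlinarith
    · filter_upwards [hle, (hZ s).2, (hZ a).2, (hZ b).2] with ω h0 h1 h2 h3
      have e1 : Real.log (Z a ω) - Real.log (Z s ω) ≤ Z a ω / Z s ω - 1 := by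
        rw [← Real.log_div h2.ne' h1.ne']
        exact Real.log_le_sub_one_of_pos (div_pos h2 h1)
      have e2 : Real.log (Z b ω) - Real.log (Z a ω) ≤
          Z b ω / Z a ω - 1 - D.indicator (fun _ => κ ^ 2 / 4) ω := by
        rw [← Real.log_div h3.ne' h2.ne']
        by_cases hd : ω ∈ D
        · rw [indicator_of_mem hd]
          refine log_le_sub_one_sub_sq (div_pos h3 h2) hκ0.le hκ ?_
          rw [Real.log_div h3.ne' h2.ne', abs_sub_comm]
          exact hd
        · rw [indicator_of_notMem hd, sub_zero]
          exact Real.log_le_sub_one_of_pos (div_pos h3 h2)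
      linarith

theorem nhdsLT_neBot_of_pos {u : Icc (0 : ℝ) T} (hu : 0 < (u : ℝ)) : (𝓝[<] u).NeBot := by
  let z : Icc (0 : ℝ) T := ⟨0, le_rfl, hu.le.trans u.2.2⟩
  exact nhdsLT_neBot_of_exists_lt ⟨z, hu⟩

/-- If the ratios of a strictly positive process have expectation at most one, its logarithm has
left limits in probability. -/
theorem exists_log_leftLimit [IsProbabilityMeasure P] {Z : StochProc T Ω}
    (hZ : IsStrictlyPos P Z) (hr : HasRatioLeOne P Z) {u : Icc (0 : ℝ) T} (hu : 0 < (u : ℝ)) :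
    ∃ L : Ω → ℝ, Measurable L ∧
      TendstoInMeasure P (fun t ω => Real.log (Z t ω)) (𝓝[<] u) L := by
  have := nhdsLT_neBot_of_pos hu
  refine exists_tendstoInMeasure_of_cauchy (fun t => (hZ t).1.log.aemeasurable) fun κ' hκ' => ?_
  by_contra hcon
  obtain ⟨κ, hκ0, hκ, hκκ⟩ : ∃ κ : ℝ, 0 < κ ∧ κ ≤ 1 ∧ κ ≤ κ' :=
    ⟨min κ' 1, by positivity, min_le_right _ _, min_le_left _ _⟩
  have hosc : ∀ s < u, ∃ a b, s ≤ a ∧ a ≤ b ∧ b < u ∧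
      κ < P.real {ω | κ ≤ |Real.log (Z a ω) - Real.log (Z b ω)|} := by
    intro s hs
    by_contra! hno
    refine hcon (eventually_prod_self_iff
      (r := fun a b => P {ω | κ' ≤ |Real.log (Z a ω) - Real.log (Z b ω)|} ≤ ENNReal.ofReal κ').2
      ⟨Ioo s u, Ioo_mem_nhdsLT hs, fun a ha b hb => ?_⟩)
    have hsub : P {ω | κ' ≤ |Real.log (Z a ω) - Real.log (Z b ω)|} ≤
        P {ω | κ ≤ |Real.log (Z a ω) - Real.log (Z b ω)|} :=
      measure_mono fun ω hω => hκκ.trans hω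
    refine hsub.trans ((ENNReal.le_ofReal_iff_toReal_le (measure_ne_top _ _) hκ'.le).2
      (le_trans ?_ hκκ))
    rcases le_total a b with hab | hab
    · exact hno a b ha.1.le hab hb.2
    · simp_rw [abs_sub_comm (Real.log (Z a _))]
      exact hno b a hb.1.le hab ha.2
  let s₀ : Icc (0 : ℝ) T := ⟨0, le_rfl, hu.le.trans u.2.2⟩
  have hs₀ : s₀ < u := hu
  -- The floor `c` for `Z u / Z s₀` stops the descent: on `G`, `log c` is at most `h` plus a ratio
  -- of mean at most one, so `K` oscillations are impossible once `K * (κ ^ 3 / 16)` exceeds `1 +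
  -- |log c|`.
  obtain ⟨c, hc, hPc⟩ := exists_measureReal_lt_le ((hZ u).1.div (hZ s₀).1)
    (by filter_upwards [(hZ u).2, (hZ s₀).2] with ω h1 h2 using div_pos h1 h2)
    (show 0 < κ ^ 3 / 16 by positivity)
  set G : Set Ω := {ω | (Z u / Z s₀) ω < c}ᶜ with hGdef
  have hG : MeasurableSet G :=
    (measurableSet_lt ((hZ u).1.div (hZ s₀).1) measurable_const).compl
  obtain ⟨K, hK⟩ := exists_nat_gt ((1 + |Real.log c|) / (κ ^ 3 / 16))
  rw [div_lt_iff₀ (by positivity)] at hK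
  obtain ⟨s, hs, hsu, h, hh, hhG, hle⟩ := exists_log_le_of_oscillation hZ hr hs₀ hκ0 hκ hosc hG
    (by rwa [hGdef, compl_compl]) K
  obtain ⟨hx, hx1⟩ := hr.integrable hZ hsu.le
  have e1 : ∫ ω in G, Z u ω / Z s ω ∂P ≤ 1 := (setIntegral_le_integral hx (by
        filter_upwards [(hZ u).2, (hZ s).2] with ω h1 h2
        exact (div_pos h1 h2).le)).trans hx1
  have e2 : ∫ _ in G, Real.log c ∂P ≤ ∫ ω in G, (h ω + Z u ω / Z s ω) ∂P := by
    refine setIntegral_mono_on_ae (integrable_const _).integrableOn (hh.add hx).integrableOn hG ?_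
    filter_upwards [hle, (hZ s).2, (hZ s₀).2, (hZ u).2] with ω h0 h1 h2 h3 hω
    have h4 : c ≤ Z u ω / Z s₀ ω := not_lt.1 hω
    have h5 := Real.log_le_log hc h4
    have h6 := Real.log_le_sub_one_of_pos (div_pos h3 h1)
    rw [Real.log_div h3.ne' h2.ne'] at h5
    rw [Real.log_div h3.ne' h1.ne'] at h6
    linarith
  rw [integral_add hh.integrableOn hx.integrableOn, setIntegral_const, smul_eq_mul] at e2
  have e3 : -|Real.log c| ≤ P.real G * Real.log c := by
    have := measureReal_le_one (μ := P) (s := G)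
    have h0 : 0 ≤ P.real G := measureReal_nonneg
    nlinarith [neg_abs_le (Real.log c), abs_nonneg (Real.log c)]
  linarith

end LeftLimits

/-! ### Near maximisers of a bounded logarithmic utility. -/

section NearMaximiser

/-- An approximation of `f / g` that is bounded for every `ε > 0`. -/
noncomputable def approxRatio (ε f g : ℝ) : ℝ :=
  f / (((1 - ε) * g + ε * (f + 1)) * (1 + ε * g))

theorem approxRatio_nonneg {ε f g : ℝ} (hε0 : 0 < ε) (hε : ε ≤ 1 / 2) (hf : 0 ≤ f) (hg : 0 ≤ g) :
    0 ≤ approxRatio ε f g := by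
  have : 0 ≤ 1 - ε := by linarith
  unfold approxRatio
  positivity

theorem approxRatio_le {ε f g : ℝ} (hε0 : 0 < ε) (hε : ε ≤ 1 / 2) (hf : 0 ≤ f) (hg : 0 ≤ g) :
    approxRatio ε f g ≤ 1 / ε := by
  have h1 : 0 ≤ (1 - ε) * g := mul_nonneg (by linarith) hg
  have h2 : 0 ≤ ε * g := by positivity
  unfold approxRatio
  rw [div_le_div_iff₀ (by positivity) hε0, one_mul]
  calc f * ε ≤ ((1 - ε) * g + ε * (f + 1)) * 1 := by linarith
    _ ≤ _ := by gcongr; linarith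

/-- A bounded concave substitute for the logarithm. -/
noncomputable def boundedLog (ε x : ℝ) : ℝ := Real.log ((x + ε) / (1 + ε * x))

theorem abs_boundedLog_le {ε x : ℝ} (hε0 : 0 < ε) (hε : ε ≤ 1 / 2) (hx : 0 ≤ x) :
    |boundedLog ε x| ≤ -Real.log ε := by
  unfold boundedLog
  rw [abs_le]
  constructor
  · rw [neg_neg]
    refine Real.log_le_log hε0 ?_
    rw [le_div_iff₀ (by positivity)]
    nlinarith [mul_nonneg hε0.le hx]
  · rw [← Real.log_inv]
    refine Real.log_le_log (by positivity) ?_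
    rw [div_le_iff₀ (by positivity), inv_mul_eq_div, le_div_iff₀ hε0]
    nlinarith [mul_nonneg hε0.le hx]

/-- Apply `log y ≥ 1 - 1 / y` to the quotient of the two arguments of the logarithm. What results is
`ε * (1 - ε ^ 2) * (f - g)` over the denominator of `approxRatio`, and the `g` term is at most `1 +
2 * ε`. -/
theorem approxRatio_le_boundedLog_sub {ε f g : ℝ} (hε0 : 0 < ε) (hε : ε ≤ 1 / 2) (hf : 0 ≤ f)
    (hg : 0 ≤ g) :
    ε * (1 - ε ^ 2) * (approxRatio ε f g - (1 + 2 * ε)) ≤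
      boundedLog ε ((1 - ε) * g + ε * f) - boundedLog ε g := by
  set h := (1 - ε) * g + ε * f with hh
  have h1 : 0 ≤ (1 - ε) * g := mul_nonneg (by linarith) hg
  have hh0 : 0 ≤ h := by positivity
  have hD : 0 < (h + ε) * (1 + ε * g) := by positivity
  have e0 : approxRatio ε f g = f / ((h + ε) * (1 + ε * g)) := by
    rw [approxRatio, hh]; ring_nf
  have e1 : g / ((h + ε) * (1 + ε * g)) ≤ 1 + 2 * ε := by
    rw [div_le_iff₀ hD]
    have a1 : (1 + 2 * ε) * (1 - ε) ≥ 1 := by nlinarith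
    have a2 : g ≤ (1 + 2 * ε) * (h + ε) := by
      have : (1 - ε) * g ≤ h + ε := by rw [hh]; nlinarith [mul_nonneg hε0.le hf]
      nlinarith
    have a3 : 0 ≤ (1 + 2 * ε) * (h + ε) * (ε * g) := by positivity
    nlinarith
  have e2 : boundedLog ε h - boundedLog ε g =
      Real.log ((h + ε) * (1 + ε * g) / ((g + ε) * (1 + ε * h))) := by
    unfold boundedLog
    rw [← Real.log_div (by positivity) (by positivity)]
    congr 1
    field_simp
  rw [e2, e0]
  refine le_trans ?_ (Real.one_sub_inv_le_log_of_pos (by positivity))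
  have e3 : 1 - ((h + ε) * (1 + ε * g) / ((g + ε) * (1 + ε * h)))⁻¹ =
      ε * (1 - ε ^ 2) * (f / ((h + ε) * (1 + ε * g)) - g / ((h + ε) * (1 + ε * g))) := by
    have : ε * (f - g) = h - g := by rw [hh]; ring
    rw [← sub_div, inv_div, mul_div_assoc', eq_div_iff hD.ne', sub_mul, div_mul_cancel₀ _ hD.ne',
      mul_right_comm, this]
    ring
  rw [e3]
  have : 0 ≤ ε * (1 - ε ^ 2) := mul_nonneg hε0.le (by nlinarith)
  gcongr

variable {Ω : Type*} {m : MeasurableSpace Ω} {P : Measure Ω} [IsProbabilityMeasure P]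

theorem measurable_approxRatio {ε : ℝ} {f g : Ω → ℝ} (hf : Measurable f) (hg : Measurable g) :
    Measurable fun ω => approxRatio ε (f ω) (g ω) := by
  unfold approxRatio
  fun_prop

theorem integrable_approxRatio {ε : ℝ} (hε0 : 0 < ε) (hε : ε ≤ 1 / 2) {f g : Ω → ℝ}
    (hf : Measurable f) (hg : Measurable g) (hf0 : ∀ᵐ ω ∂P, 0 ≤ f ω) (hg0 : ∀ᵐ ω ∂P, 0 ≤ g ω) :
    Integrable (fun ω => approxRatio ε (f ω) (g ω)) P := by
  refine Integrable.of_bound (measurable_approxRatio hf hg).aestronglyMeasurable (1 / ε) ?_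
  filter_upwards [hf0, hg0] with ω h1 h2
  rw [Real.norm_eq_abs, abs_of_nonneg (approxRatio_nonneg hε0 hε h1 h2)]
  exact approxRatio_le hε0 hε h1 h2

theorem integrable_boundedLog {ε : ℝ} (hε0 : 0 < ε) (hε : ε ≤ 1 / 2) {f : Ω → ℝ}
    (hf : Measurable f) (hf0 : ∀ᵐ ω ∂P, 0 ≤ f ω) :
    Integrable (fun ω => boundedLog ε (f ω)) P := by
  refine Integrable.of_bound (C := -Real.log ε) ?_ (hf0.mono fun ω h => abs_boundedLog_le hε0 hε h)
  unfold boundedLog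
  exact (by fun_prop : Measurable _).aestronglyMeasurable

/-- In a convex set of nonnegative random variables, near maximisers of the expected bounded
logarithm are approximate numéraires. -/
theorem exists_integral_approxRatio_le {C : Set (Ω → ℝ)} (hne : C.Nonempty)
    (hC : ∀ f ∈ C, Measurable f ∧ ∀ᵐ ω ∂P, 0 ≤ f ω)
    (hconv : ∀ f ∈ C, ∀ g ∈ C, ∀ α ∈ Icc (0 : ℝ) 1,
      ∃ h ∈ C, h =ᵐ[P] fun ω => (1 - α) * f ω + α * g ω)
    {ε : ℝ} (hε0 : 0 < ε) (hε : ε ≤ 1 / 2) :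
    ∃ g ∈ C, ∀ f ∈ C, ∫ ω, approxRatio ε (f ω) (g ω) ∂P ≤ 1 + 4 * ε := by
  set S : Set ℝ := (fun f : Ω → ℝ => ∫ ω, boundedLog ε (f ω) ∂P) '' C
  have hbdd : BddAbove S := by
    refine ⟨-Real.log ε, ?_⟩
    rintro _ ⟨f, hf, rfl⟩
    refine (integral_mono_ae (integrable_boundedLog hε0 hε (hC f hf).1 (hC f hf).2)
      (integrable_const (-Real.log ε)) ?_).trans (by simp)
    exact (hC f hf).2.mono fun ω h => (abs_le.1 (abs_boundedLog_le hε0 hε h)).2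
  -- The slack is `ε ^ 2` because the perturbation has step `ε`: dividing by `ε * (1 - ε ^ 2)`
  -- leaves an error of order `ε`.
  obtain ⟨_, ⟨g, hg, rfl⟩, hgmax⟩ :=
    exists_lt_of_lt_csSup (hne.image _) (sub_lt_self (sSup S) (by positivity : 0 < ε ^ 2))
  refine ⟨g, hg, fun f hf => ?_⟩
  obtain ⟨h, hh, hhe⟩ := hconv g hg f hf ε ⟨hε0.le, by linarith⟩
  have h1 : ∫ ω, boundedLog ε (h ω) ∂P ≤ sSup S := le_csSup hbdd ⟨h, hh, rfl⟩
  have hif := integrable_approxRatio hε0 hε (hC f hf).1 (hC g hg).1 (hC f hf).2 (hC g hg).2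
  have hig := integrable_boundedLog hε0 hε (hC g hg).1 (hC g hg).2
  have hih := integrable_boundedLog hε0 hε (hC h hh).1 (hC h hh).2
  have hiF : Integrable (fun ω => ε * (1 - ε ^ 2) * (approxRatio ε (f ω) (g ω) - (1 + 2 * ε))) P :=
    (hif.sub (integrable_const (1 + 2 * ε))).const_mul _
  have h2 : ∫ ω, ε * (1 - ε ^ 2) * (approxRatio ε (f ω) (g ω) - (1 + 2 * ε)) ∂P ≤
      ∫ ω, (boundedLog ε (h ω) - boundedLog ε (g ω)) ∂P := by
    refine integral_mono_ae hiF (hih.sub hig) ?_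
    filter_upwards [(hC f hf).2, (hC g hg).2, hhe] with ω a1 a2 a3
    rw [a3]
    exact approxRatio_le_boundedLog_sub hε0 hε a1 a2
  rw [integral_sub hih hig, integral_const_mul, integral_sub hif (integrable_const _)] at h2
  simp only [integral_const, probReal_univ, smul_eq_mul, one_mul] at h2
  have h3 : ε * ((1 - ε ^ 2) * (∫ ω, approxRatio ε (f ω) (g ω) ∂P - (1 + 2 * ε))) ≤ ε * ε := by
    nlinarith
  have h4 := le_of_mul_le_mul_left h3 hε0
  by_contra! h5
  have h6 : 3 / 4 ≤ 1 - ε ^ 2 := by nlinarith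
  nlinarith [mul_le_mul_of_nonneg_right h6 (by linarith :
    0 ≤ ∫ ω, approxRatio ε (f ω) (g ω) ∂P - (1 + 2 * ε))]

/-- Precision `δ' ^ 2` is negligible against both bounds on `g`: `δ' ^ 2 ≤ δ * g` and `δ' ^ 2 * g ≤
δ`. Each factor of the denominator then loses only a factor `1 + δ`, apart from the truncation `1 +
δ * R`. -/
theorem le_approxRatio_mul {δ δ' R g : ℝ} (hδ' : 0 < δ') (hδδ : δ' ≤ δ) (hδ : δ ≤ 1 / 2)
    (hR : 0 < R) (hg : δ' ≤ g) (hg' : g ≤ 1 / δ') :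
    R / (1 + δ * R) ≤ (1 + δ) ^ 2 * approxRatio (δ' ^ 2) (R * g) g := by
  have hg0 : 0 < g := hδ'.trans_le hg
  rw [le_div_iff₀ hδ'] at hg'
  have hδ0 : 0 < δ := hδ'.trans_le hδδ
  have b0 : 0 < (1 - δ' ^ 2) * g := mul_pos (by nlinarith) hg0
  have b1 : 1 + δ' ^ 2 * g ≤ 1 + δ := by nlinarith
  have b2 : (1 - δ' ^ 2) * g + δ' ^ 2 * (R * g + 1) ≤ g * ((1 + δ) * (1 + δ * R)) := by
    have c1 : δ' ^ 2 ≤ δ * g := by nlinarith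
    have c2 : δ' ^ 2 * (R * g) ≤ δ * (R * g) := by
      gcongr
      nlinarith
    have c3 : 0 ≤ δ ^ 2 * (R * g) := by positivity
    nlinarith [mul_pos (pow_pos hδ' 2) hg0]
  unfold approxRatio
  rw [mul_div_assoc', div_le_div_iff₀ (by positivity) (by positivity)]
  calc R * (((1 - δ' ^ 2) * g + δ' ^ 2 * (R * g + 1)) * (1 + δ' ^ 2 * g))
      ≤ R * (g * ((1 + δ) * (1 + δ * R)) * (1 + δ)) := by gcongr
    _ = (1 + δ) ^ 2 * (R * g) * (1 + δ * R) := by ring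

/-- A truncated, quantitative form of `R + 1 / R ≥ 2`; the excess term is what measures the distance
between near maximisers. -/
theorem le_div_add_inv_div {δ R : ℝ} (hδ0 : 0 < δ) (hδ : δ ≤ 1 / 2) (hR : 0 < R) :
    2 / (1 + δ) + (1 - δ) / (1 + δ) * ((R - 1) / (R + 1)) ^ 2 ≤
      R / (1 + δ * R) + R⁻¹ / (1 + δ * R⁻¹) := by
  have e : R / (1 + δ * R) + R⁻¹ / (1 + δ * R⁻¹) - 2 / (1 + δ) =
      (1 - δ) / (1 + δ) * ((R - 1) ^ 2 / ((1 + δ * R) * (R + δ))) := by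
    have : R + δ ≠ 0 := by positivity
    field_simp
    ring
  have e2 : ((R - 1) / (R + 1)) ^ 2 ≤ (R - 1) ^ 2 / ((1 + δ * R) * (R + δ)) := by
    rw [div_pow]
    gcongr
    rw [sq]
    exact mul_le_mul (by nlinarith) (by linarith) (by positivity) (by positivity)
  have : 0 ≤ (1 - δ) / (1 + δ) := div_nonneg (by linarith) (by linarith)
  have := mul_le_mul_of_nonneg_left e2 this
  linarith

theorem sq_le_of_le_abs_log {κ R : ℝ} (hκ : 0 < κ) (hR : 0 < R) (h : κ ≤ |Real.log R|) :
    (κ / (2 + κ)) ^ 2 ≤ ((R - 1) / (R + 1)) ^ 2 := by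
  have key : ∀ R : ℝ, 0 < R → κ ≤ Real.log R → κ / (2 + κ) ≤ (R - 1) / (R + 1) := by
    intro R hR h
    have : κ ≤ R - 1 := h.trans (Real.log_le_sub_one_of_pos hR)
    rw [div_le_div_iff₀ (by positivity) (by positivity)]
    nlinarith
  rcases le_abs.1 h with h | h
  · exact pow_le_pow_left₀ (by positivity) (key R hR h) 2
  · rw [← Real.log_inv] at h
    have h1 := pow_le_pow_left₀ (by positivity) (key R⁻¹ (inv_pos.2 hR) h) 2
    have e : (R⁻¹ - 1) / (R⁻¹ + 1) = -((R - 1) / (R + 1)) := by field_simp; ring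
    rwa [e, neg_sq] at h1

end NearMaximiser

/-! ### Approximate numéraires and their closeness uniformly in time. -/

section Approximation

variable {Ω : Type*} {m : MeasurableSpace Ω} {P : Measure Ω} {T : ℝ}
  {ℱ : Filtration (Icc (0 : ℝ) T) m} {𝒳 : Set (StochProc T Ω)}

theorem switch_apply_of_mem {τ t : Icc (0 : ℝ) T} {A : Set Ω} {X X' : StochProc T Ω} {ω : Ω}
    (ht : τ ≤ t) (hω : ω ∈ A) : switch τ A X X' t ω = X τ ω / X' τ ω * X' t ω :=
  if_neg (by rw [not_or, not_not]; exact ⟨not_lt.2 ht, hω⟩)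

theorem switch_apply_of_notMem {τ t : Icc (0 : ℝ) T} {A : Set Ω} {X X' : StochProc T Ω} {ω : Ω}
    (hω : ω ∉ A) : switch τ A X X' t ω = X t ω :=
  if_pos (Or.inr hω)

theorem IsStrictlyPos.of_memUpToModification (hn : ∀ X ∈ 𝒳, IsNonneg P X) {V : StochProc T Ω}
    (hV : IsStrictlyPos P V) {X : StochProc T Ω} (hX : X ∈ 𝒳) (h : ∀ t, X t =ᵐ[P] V t) :
    IsStrictlyPos P X :=
  fun t => ⟨(hn X hX t).1, by filter_upwards [h t, (hV t).2] with ω h1 h2 using h1 ▸ h2⟩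

theorem IsStrictlyPos.switch {τ : Icc (0 : ℝ) T} {A : Set Ω} (hA : MeasurableSet A)
    {X X' : StochProc T Ω} (hX : IsStrictlyPos P X) (hX' : IsStrictlyPos P X') :
    IsStrictlyPos P (switch τ A X X') := by
  intro t
  constructor
  · unfold LimitedInfo.switch
    exact Measurable.ite ((MeasurableSet.const (t < τ)).union hA.compl) (hX t).1
      (((hX τ).1.div (hX' τ).1).mul (hX' t).1)
  · filter_upwards [(hX t).2, (hX τ).2, (hX' τ).2, (hX' t).2] with ω h1 h2 h3 h4
    unfold LimitedInfo.switch
    split_ifs <;> positivity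

theorem IsStrictlyPos.convexComb {X X' : StochProc T Ω} (hX : IsNonneg P X)
    (hX' : IsStrictlyPos P X') {α : ℝ} (hα0 : 0 < α) (hα1 : α ≤ 1) :
    IsStrictlyPos P (fun t ω => (1 - α) * X t ω + α * X' t ω) := by
  intro t
  refine ⟨((hX t).1.const_mul _).add ((hX' t).1.const_mul _), ?_⟩
  filter_upwards [(hX t).2, (hX' t).2] with ω h1 h2
  have : 0 ≤ (1 - α) * X t ω := mul_nonneg (by linarith) h1
  positivity

/-- `X` is an approximate numéraire at time `b`, with precision `ε`. -/
def IsApproxNumeraire (P : Measure Ω) (𝒳 : Set (StochProc T Ω)) (b : Icc (0 : ℝ) T)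
    (Xbar : StochProc T Ω) (ε : ℝ) (X : StochProc T Ω) : Prop :=
  X ∈ 𝒳 ∧ IsStrictlyPos P X ∧ ∀ V, MemUpToModification P 𝒳 V → IsStrictlyPos P V →
    ∫ ω, approxRatio ε (V b ω / Xbar b ω) (X b ω / Xbar b ω) ∂P ≤ 1 + 4 * ε

theorem IsStrictlyPos.div_pos {X X' : StochProc T Ω} (hX : IsStrictlyPos P X)
    (hX' : IsStrictlyPos P X') (s t : Icc (0 : ℝ) T) :
    Measurable (fun ω => X s ω / X' t ω) ∧ ∀ᵐ ω ∂P, 0 < X s ω / X' t ω :=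
  ⟨(hX s).1.div (hX' t).1, by
    filter_upwards [(hX s).2, (hX' t).2] with ω h1 h2 using _root_.div_pos h1 h2⟩

/-- The event that the terminal value of `X` relative to `Xbar` is neither small nor large. -/
def tameEvent (b : Icc (0 : ℝ) T) (Xbar : StochProc T Ω) (δ : ℝ) (X : StochProc T Ω) : Set Ω :=
  {ω | δ ≤ X b ω / Xbar b ω ∧ X b ω / Xbar b ω ≤ 1 / δ}

theorem measurableSet_tameEvent {b : Icc (0 : ℝ) T} {Xbar X : StochProc T Ω} {δ : ℝ}
    (hpos : IsStrictlyPos P Xbar) (hX : IsStrictlyPos P X) :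
    MeasurableSet (tameEvent b Xbar δ X) :=
  (measurableSet_le measurable_const (hX.div_pos hpos b b).1).inter
    (measurableSet_le (hX.div_pos hpos b b).1 measurable_const)

variable [IsProbabilityMeasure P]

theorem exists_isApproxNumeraire (hn : ∀ X ∈ 𝒳, IsNonneg P X) (hc : IsConvex P 𝒳)
    {Xbar : StochProc T Ω} (hXbar : Xbar ∈ 𝒳) (hpos : IsStrictlyPos P Xbar) (b : Icc (0 : ℝ) T)
    {ε : ℝ} (hε0 : 0 < ε) (hε : ε ≤ 1 / 2) :
    ∃ X, IsApproxNumeraire P 𝒳 b Xbar ε X := by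
  have key := exists_integral_approxRatio_le (P := P)
    (C := (fun X : StochProc T Ω => fun ω => X b ω / Xbar b ω) '' {X | X ∈ 𝒳 ∧ IsStrictlyPos P X})
    ⟨_, Xbar, ⟨hXbar, hpos⟩, rfl⟩ ?_ ?_ hε0 hε
  · obtain ⟨_, ⟨X, ⟨hX, hXpos⟩, rfl⟩, h⟩ := key
    refine ⟨X, hX, hXpos, fun V ⟨V', hV', hVV⟩ hV => ?_⟩
    refine le_trans (integral_congr_ae ?_).le
      (h _ ⟨V', ⟨hV', hV.of_memUpToModification hn hV' hVV⟩, rfl⟩)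
    filter_upwards [hVV b] with ω hω
    rw [hω]
  · rintro _ ⟨X, ⟨-, hX⟩, rfl⟩
    exact ⟨(hX.div_pos hpos b b).1, (hX.div_pos hpos b b).2.mono fun _ h => h.le⟩
  · rintro _ ⟨X, ⟨hX, hX0⟩, rfl⟩ _ ⟨X', ⟨hX', hX'0⟩, rfl⟩ α hα
    obtain ⟨V, hV, hVe⟩ := hc X hX X' hX' α hα
    have hV0 : IsStrictlyPos P V := by
      refine fun t => ⟨(hn V hV t).1, ?_⟩
      filter_upwards [hVe t, (hX0 t).2, (hX'0 t).2] with ω h1 h2 h3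
      rw [h1]
      rcases hα.1.eq_or_lt with h0 | h0
      · simpa [← h0] using h2
      · have : 0 ≤ (1 - α) * X t ω := mul_nonneg (by linarith [hα.2]) h2.le
        positivity
    refine ⟨_, ⟨V, ⟨hV, hV0⟩, rfl⟩, ?_⟩
    filter_upwards [hVe b] with ω h1
    simp only [h1]
    ring

/-- Where `X` is small relative to `Xbar`, the competitor `Xbar` has truncated ratio at least `1 /
(4 * δ)`, while its mean is at most two; Markov's inequality concludes. Dividing by `Xbar` turns
this competitor into the constant one. -/
theorem IsApproxNumeraire.measureReal_lt_le {b : Icc (0 : ℝ) T} {Xbar X : StochProc T Ω} {δ : ℝ}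
    (hXbar : Xbar ∈ 𝒳) (hpos : IsStrictlyPos P Xbar) (hδ0 : 0 < δ) (hδ : δ ≤ 1 / 2)
    (hX : IsApproxNumeraire P 𝒳 b Xbar (δ ^ 2) X) :
    P.real {ω | X b ω / Xbar b ω < δ} ≤ 8 * δ := by
  have hε : δ ^ 2 ≤ 1 / 2 := by nlinarith
  obtain ⟨gm, g0⟩ := hX.2.1.div_pos hpos b b
  obtain ⟨fm, f0⟩ := hpos.div_pos hpos b b
  have h1 := hX.2.2 Xbar ⟨Xbar, hXbar, fun _ => ae_eq_rfl⟩ hpos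
  have hi := integrable_approxRatio (pow_pos hδ0 2) hε fm gm (f0.mono fun _ h => h.le)
    (g0.mono fun _ h => h.le)
  have hnn : 0 ≤ᵐ[P] fun ω => approxRatio (δ ^ 2) (Xbar b ω / Xbar b ω) (X b ω / Xbar b ω) := by
    filter_upwards [f0, g0] with ω h1 h2
    exact approxRatio_nonneg (pow_pos hδ0 2) hε h1.le h2.le
  have h2 := mul_meas_ge_le_integral_of_nonneg hnn hi (1 / (4 * δ))
  have h3 : P.real {ω | X b ω / Xbar b ω < δ} ≤ P.real {ω | 1 / (4 * δ) ≤
      approxRatio (δ ^ 2) (Xbar b ω / Xbar b ω) (X b ω / Xbar b ω)} := by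
    refine ENNReal.toReal_mono (measure_ne_top _ _) (measure_mono_ae ?_)
    filter_upwards [(hpos b).2, g0] with ω a1 a2 (a3 : X b ω / Xbar b ω < δ)
    change _ ≤ _
    rw [div_self a1.ne']
    set g := X b ω / Xbar b ω
    have b0 : 0 < (1 - δ ^ 2) * g := mul_pos (by linarith) a2
    unfold approxRatio
    refine one_div_le_one_div_of_le (by positivity) ?_
    have c1 : (1 - δ ^ 2) * g + δ ^ 2 * (1 + 1) ≤ 2 * δ := by nlinarith
    have c2 : 1 + δ ^ 2 * g ≤ 2 := by nlinarith
    nlinarith [mul_le_mul c1 c2 (by positivity) (by positivity)]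
  have h4 : 1 / (4 * δ) * P.real {ω | X b ω / Xbar b ω < δ} ≤ 2 :=
    (mul_le_mul_of_nonneg_left h3 (by positivity)).trans (h2.trans (h1.trans (by nlinarith)))
  rw [one_div, inv_mul_le_iff₀ (by positivity)] at h4
  linarith

theorem IsBoundedInProb.exists_measureReal_div_le {b : Icc (0 : ℝ) T} {Xbar : StochProc T Ω}
    (hpos : IsStrictlyPos P Xbar) (hbd : IsBoundedInProb P (valuesAt 𝒳 b)) {η : ℝ} (hη : 0 < η) :
    ∃ δ₀ > 0, ∀ δ, 0 < δ → δ ≤ δ₀ → ∀ X ∈ 𝒳, P.real {ω | 1 / δ < X b ω / Xbar b ω} ≤ η := by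
  obtain ⟨c, hc, hPc⟩ := exists_measureReal_lt_le (hpos b).1 (hpos b).2 (half_pos hη)
  obtain ⟨ℓ, hℓ, hℓ0⟩ := ((hbd.eventually_le_const
    (ENNReal.ofReal_pos.2 (half_pos hη))).and (eventually_gt_atTop 0)).exists
  refine ⟨c / ℓ, by positivity, fun δ hδ0 hδ X hX => ?_⟩
  have h1 : P.real {ω | ℓ < X b ω} ≤ η / 2 := by
    refine ENNReal.toReal_le_of_le_ofReal (by positivity) (le_trans ?_ hℓ)
    exact le_iSup₂ (f := fun (f : Ω → ℝ) (_ : f ∈ valuesAt 𝒳 b) => P {ω | ℓ < f ω}) (X b)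
      ⟨X, hX, rfl⟩
  have h2 : P.real {ω | 1 / δ < X b ω / Xbar b ω} ≤
      P.real ({ω | ℓ < X b ω} ∪ {ω | Xbar b ω < c}) := by
    refine ENNReal.toReal_mono (measure_ne_top _ _) (measure_mono_ae ?_)
    filter_upwards [(hpos b).2] with ω a1 (a2 : 1 / δ < X b ω / Xbar b ω)
    by_cases hcω : Xbar b ω < c
    · exact Or.inr hcω
    · refine Or.inl ?_
      rw [lt_div_iff₀ a1] at a2
      rw [le_div_iff₀ hℓ0] at hδ
      refine lt_of_le_of_lt ?_ a2
      rw [div_mul_eq_mul_div, le_div_iff₀ hδ0]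
      linarith
  linarith [measureReal_union_le (μ := P) {ω | ℓ < X b ω} {ω | Xbar b ω < c}]

theorem exists_measureReal_tameEvent_compl_le {b : Icc (0 : ℝ) T} {Xbar : StochProc T Ω}
    (hXbar : Xbar ∈ 𝒳) (hpos : IsStrictlyPos P Xbar) (hbd : IsBoundedInProb P (valuesAt 𝒳 b))
    {η : ℝ} (hη : 0 < η) :
    ∃ δ₀ > 0, ∀ δ, 0 < δ → δ ≤ δ₀ → ∀ X, IsApproxNumeraire P 𝒳 b Xbar (δ ^ 2) X →
      P.real (tameEvent b Xbar δ X)ᶜ ≤ η := by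
  obtain ⟨δ₁, hδ₁, h⟩ := hbd.exists_measureReal_div_le hpos (half_pos hη)
  refine ⟨min δ₁ (min (1 / 2) (η / 16)), by positivity, fun δ hδ0 hδ X hX => ?_⟩
  obtain ⟨d1, d2⟩ := le_min_iff.1 hδ
  obtain ⟨d2, d3⟩ := le_min_iff.1 d2
  have h1 := h δ hδ0 d1 X hX.1
  have h2 := hX.measureReal_lt_le hXbar hpos hδ0 d2
  have h3 : (tameEvent b Xbar δ X)ᶜ ⊆
      {ω | 1 / δ < X b ω / Xbar b ω} ∪ {ω | X b ω / Xbar b ω < δ} := by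
    intro ω hω
    by_contra hcon
    simp only [mem_union, not_or] at hcon
    exact hω ⟨not_lt.1 hcon.2, not_lt.1 hcon.1⟩
  linarith [(measureReal_mono h3 (μ := P)).trans (measureReal_union_le _ _)]

theorem integrable_div_one_add {δ : ℝ} (hδ : 0 < δ) {R : Ω → ℝ} (hR : Measurable R)
    (hR0 : ∀ᵐ ω ∂P, 0 < R ω) : Integrable (fun ω => R ω / (1 + δ * R ω)) P := by
  refine Integrable.of_bound (by fun_prop : Measurable _).aestronglyMeasurable (1 / δ) ?_
  filter_upwards [hR0] with ω h
  rw [Real.norm_eq_abs, abs_of_pos (by positivity), div_le_div_iff₀ (by positivity) hδ]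
  linarith

/-- Switching lets the terminal near-optimality of `X` control ratios at an arbitrary time `t`, with
a bound independent of `t`. -/
theorem IsApproxNumeraire.setIntegral_ratio_le {b : Icc (0 : ℝ) T} (hb : IsTop b)
    {Xbar X X' : StochProc T Ω} {δ δ' : ℝ} (hd : HasSwitching P ℱ 𝒳)
    (hpos : IsStrictlyPos P Xbar) (hδ' : 0 < δ')
    (hδδ : δ' ≤ δ) (hδ : δ ≤ 1 / 2) (hX : IsApproxNumeraire P 𝒳 b Xbar (δ' ^ 2) X)
    (hX' : X' ∈ 𝒳) (hX'0 : IsStrictlyPos P X') (t : Icc (0 : ℝ) T) {G : Set Ω}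
    (hG : MeasurableSet G) (hGs : G ⊆ tameEvent b Xbar δ' X) :
    ∫ ω in G, (X' t ω / X t ω) / (1 + δ * (X' t ω / X t ω)) ∂P ≤ (1 + δ) ^ 2 * (1 + 4 * δ ^ 2) := by
  have hδ0 := hδ'.trans_le hδδ
  have hε : δ' ^ 2 ≤ 1 / 2 := by nlinarith
  -- Since `X` is followed from `t` onwards, `V b / X b` equals `X' t / X t`.
  set V := switch t univ X' X with hV
  have hVm : MemUpToModification P 𝒳 V := hd t univ MeasurableSet.univ X' hX' X hX.1 hX.2.1
  have hV0 : IsStrictlyPos P V := hX'0.switch MeasurableSet.univ hX.2.1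
  have h1 := hX.2.2 V hVm hV0
  obtain ⟨gm, g0⟩ := hX.2.1.div_pos hpos b b
  obtain ⟨fm, f0⟩ := hV0.div_pos hpos b b
  obtain ⟨Rm, R0⟩ := hX'0.div_pos hX.2.1 t t
  have hi := integrable_approxRatio (pow_pos hδ' 2) hε fm gm (f0.mono fun _ h => h.le)
    (g0.mono fun _ h => h.le)
  have hnn : 0 ≤ᵐ[P] fun ω => approxRatio (δ' ^ 2) (V b ω / Xbar b ω) (X b ω / Xbar b ω) := by
    filter_upwards [f0, g0] with ω h1 h2
    exact approxRatio_nonneg (pow_pos hδ' 2) hε h1.le h2.le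
  calc ∫ ω in G, (X' t ω / X t ω) / (1 + δ * (X' t ω / X t ω)) ∂P
      ≤ ∫ ω in G, (1 + δ) ^ 2 *
          approxRatio (δ' ^ 2) (V b ω / Xbar b ω) (X b ω / Xbar b ω) ∂P := by
        refine setIntegral_mono_on_ae (integrable_div_one_add hδ0 Rm R0).integrableOn
          (hi.const_mul _).integrableOn hG ?_
        filter_upwards [R0] with ω r0 hω
        have e : V b ω / Xbar b ω = X' t ω / X t ω * (X b ω / Xbar b ω) := by
          rw [hV, switch_apply_of_mem (hb t) (mem_univ ω)]
          ring
        rw [e]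
        exact le_approxRatio_mul hδ' hδδ hδ r0 (hGs hω).1 (hGs hω).2
    _ = (1 + δ) ^ 2 * ∫ ω in G, approxRatio (δ' ^ 2) (V b ω / Xbar b ω) (X b ω / Xbar b ω) ∂P :=
        integral_const_mul _ _
    _ ≤ (1 + δ) ^ 2 * (1 + 4 * δ ^ 2) := by
        gcongr
        refine (setIntegral_le_integral hi hnn).trans (h1.trans ?_)
        gcongr

/-- Adding the two near-optimality bounds with roles exchanged leaves little room for the excess in
`R + 1 / R`, hence little mass where `log R` is large. -/
theorem measureReal_log_sub_ge_le {b : Icc (0 : ℝ) T} (hb : IsTop b)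
    {Xbar X₁ X₂ : StochProc T Ω} {δ δ₁ δ₂ η κ : ℝ} (hd : HasSwitching P ℱ 𝒳)
    (hpos : IsStrictlyPos P Xbar) (hδ₁ : 0 < δ₁) (hδ₂ : 0 < δ₂)
    (hδδ₁ : δ₁ ≤ δ) (hδδ₂ : δ₂ ≤ δ) (hδ : δ ≤ 1 / 2) (hκ : 0 < κ)
    (hX₁ : IsApproxNumeraire P 𝒳 b Xbar (δ₁ ^ 2) X₁)
    (hX₂ : IsApproxNumeraire P 𝒳 b Xbar (δ₂ ^ 2) X₂)
    (hη₁ : P.real (tameEvent b Xbar δ₁ X₁)ᶜ ≤ η) (hη₂ : P.real (tameEvent b Xbar δ₂ X₂)ᶜ ≤ η)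
    (t : Icc (0 : ℝ) T) :
    P.real {ω | κ ≤ |Real.log (X₁ t ω) - Real.log (X₂ t ω)|} ≤
      2 * η + (48 * δ + 8 * η) / (κ / (2 + κ)) ^ 2 := by
  have hδ0 := hδ₁.trans_le hδδ₁
  set G := tameEvent b Xbar δ₁ X₁ ∩ tameEvent b Xbar δ₂ X₂ with hGdef
  have hG : MeasurableSet G :=
    (measurableSet_tameEvent hpos hX₁.2.1).inter (measurableSet_tameEvent hpos hX₂.2.1)
  have hPG : P.real Gᶜ ≤ 2 * η := by
    rw [hGdef, compl_inter]
    linarith [measureReal_union_le (μ := P) (tameEvent b Xbar δ₁ X₁)ᶜ (tameEvent b Xbar δ₂ X₂)ᶜ]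
  have hPG' : 1 - 2 * η ≤ P.real G := by
    rw [probReal_compl_eq_one_sub hG] at hPG
    linarith
  have h1 := hX₁.setIntegral_ratio_le hb hd hpos hδ₁ hδδ₁ hδ hX₂.1 hX₂.2.1 t hG inter_subset_left
  have h2 := hX₂.setIntegral_ratio_le hb hd hpos hδ₂ hδδ₂ hδ hX₁.1 hX₁.2.1 t hG inter_subset_right
  obtain ⟨Rm, R0⟩ := hX₁.2.1.div_pos hX₂.2.1 t t
  obtain ⟨Rm', R0'⟩ := hX₂.2.1.div_pos hX₁.2.1 t t
  have hi1 := integrable_div_one_add hδ0 Rm R0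
  have hi2 := integrable_div_one_add hδ0 Rm' R0'
  set D := {ω | κ ≤ |Real.log (X₁ t ω) - Real.log (X₂ t ω)|} with hD
  have hDm : MeasurableSet D := measurableSet_le measurable_const
    ((hX₁.2.1 t).1.log.sub (hX₂.2.1 t).1.log).abs
  set c := (κ / (2 + κ)) ^ 2 with hc
  have hc0 : 0 < c := by positivity
  have hind : Integrable (D.indicator fun _ => (1 - δ) / (1 + δ) * c) P :=
    (integrable_const _).indicator hDm
  have hmain : ∫ ω in G, (2 / (1 + δ) + D.indicator (fun _ => (1 - δ) / (1 + δ) * c) ω) ∂P ≤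
      ∫ ω in G, ((X₁ t ω / X₂ t ω) / (1 + δ * (X₁ t ω / X₂ t ω)) +
        (X₂ t ω / X₁ t ω) / (1 + δ * (X₂ t ω / X₁ t ω))) ∂P := by
    refine setIntegral_mono_on_ae ((integrable_const _).add hind).integrableOn
      (hi1.add hi2).integrableOn hG ?_
    filter_upwards [R0, (hX₁.2.1 t).2, (hX₂.2.1 t).2] with ω r0 p1 p2 _
    have e : X₂ t ω / X₁ t ω = (X₁ t ω / X₂ t ω)⁻¹ := (inv_div _ _).symm
    rw [e]
    refine le_trans ?_ (le_div_add_inv_div hδ0 hδ r0)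
    gcongr
    have hq : 0 ≤ (1 - δ) / (1 + δ) := div_nonneg (by linarith) (by linarith)
    by_cases hω : ω ∈ D
    · rw [indicator_of_mem hω]
      refine mul_le_mul_of_nonneg_left (sq_le_of_le_abs_log hκ r0 ?_) hq
      rw [Real.log_div p1.ne' p2.ne']
      exact hω
    · rw [indicator_of_notMem hω]
      positivity
  rw [integral_add hi1.integrableOn hi2.integrableOn,
    integral_add (integrable_const _).integrableOn hind.integrableOn, setIntegral_const,
    integral_indicator hDm, Measure.restrict_restrict hDm, setIntegral_const, smul_eq_mul,
    smul_eq_mul] at hmain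
  have h3 : P.real G * (2 / (1 + δ)) + P.real (D ∩ G) * ((1 - δ) / (1 + δ) * c) ≤
      2 * ((1 + δ) ^ 2 * (1 + 4 * δ ^ 2)) := by linarith
  have h4 : P.real G * 2 + P.real (D ∩ G) * ((1 - δ) * c) ≤
      2 * ((1 + δ) ^ 3 * (1 + 4 * δ ^ 2)) := by
    have h5 := mul_le_mul_of_nonneg_right h3 (by linarith : 0 ≤ 1 + δ)
    have h6 : (P.real G * (2 / (1 + δ)) + P.real (D ∩ G) * ((1 - δ) / (1 + δ) * c)) * (1 + δ) =
        P.real G * 2 + P.real (D ∩ G) * ((1 - δ) * c) := by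
      field_simp
    rw [h6] at h5
    linarith
  have h7 : (1 + δ) ^ 3 * (1 + 4 * δ ^ 2) ≤ 1 + 12 * δ := by
    have hδ2 : δ ^ 2 ≤ δ / 2 := by nlinarith
    have hδ3 : δ ^ 3 ≤ δ / 4 := by nlinarith
    have hδ4 : δ ^ 4 ≤ δ / 8 := by nlinarith
    have hδ5 : δ ^ 5 ≤ δ / 16 := by nlinarith
    nlinarith
  -- The excess is at most `24 * δ + 4 * η`; it doubles on dividing by `1 - δ ≥ 1 / 2`.
  have h8 : P.real (D ∩ G) * c ≤ 48 * δ + 8 * η := by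
    have : 0 ≤ P.real (D ∩ G) * c := mul_nonneg measureReal_nonneg hc0.le
    nlinarith
  have h9 : P.real D ≤ P.real (D ∩ G) + P.real Gᶜ := by
    refine (measureReal_mono (fun ω hω => ?_)).trans (measureReal_union_le _ _)
    by_cases hg : ω ∈ G
    exacts [Or.inl ⟨hω, hg⟩, Or.inr hg]
  rw [← le_div_iff₀ hc0] at h8
  linarith

/-- Approximate numéraires are close to each other, uniformly in time. -/
theorem exists_measureReal_log_sub_ge_le {b : Icc (0 : ℝ) T} (hb : IsTop b)
    {Xbar : StochProc T Ω} (hd : HasSwitching P ℱ 𝒳)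
    (hXbar : Xbar ∈ 𝒳) (hpos : IsStrictlyPos P Xbar) (hbd : IsBoundedInProb P (valuesAt 𝒳 b))
    {κ : ℝ} (hκ : 0 < κ) :
    ∃ δ₀ > 0, ∀ δ₁ δ₂, 0 < δ₁ → δ₁ ≤ δ₀ → 0 < δ₂ → δ₂ ≤ δ₀ → ∀ X₁ X₂,
      IsApproxNumeraire P 𝒳 b Xbar (δ₁ ^ 2) X₁ → IsApproxNumeraire P 𝒳 b Xbar (δ₂ ^ 2) X₂ →
      ∀ t, P.real {ω | κ ≤ |Real.log (X₁ t ω) - Real.log (X₂ t ω)|} ≤ κ := by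
  set c := (κ / (2 + κ)) ^ 2 with hc
  have hc0 : 0 < c := by positivity
  have hc1 : c ≤ 1 := by
    refine pow_le_one₀ (by positivity) ?_
    rw [div_le_one₀ (by positivity)]
    linarith
  obtain ⟨δ₁, hδ₁, h⟩ := exists_measureReal_tameEvent_compl_le hXbar hpos hbd
    (show 0 < κ * c / 100 by positivity)
  -- With `η = κ * c / 100`, the quotient in the bound is at most `κ / 2`, and `2 * η` is at most `κ
  -- / 50` because `c ≤ 1`.
  refine ⟨min δ₁ (min (1 / 2) (κ * c / 200)), by positivity,
    fun a₁ a₂ ha₁ hd₁ ha₂ hd₂ X₁ X₂ hX₁ hX₂ t => ?_⟩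
  refine (measureReal_log_sub_ge_le hb hd hpos ha₁ ha₂ hd₁ hd₂
    ((min_le_right _ _).trans (min_le_left _ _)) hκ hX₁ hX₂
    (h a₁ ha₁ (hd₁.trans (min_le_left _ _)) X₁ hX₁)
    (h a₂ ha₂ (hd₂.trans (min_le_left _ _)) X₂ hX₂) t).trans ?_
  have h1 : min δ₁ (min (1 / 2) (κ * c / 200)) ≤ κ * c / 200 :=
    (min_le_right _ _).trans (min_le_right _ _)
  have h2 : (48 * min δ₁ (min (1 / 2) (κ * c / 200)) + 8 * (κ * c / 100)) / c ≤ κ / 2 := by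
    rw [div_le_iff₀ hc0]
    nlinarith [mul_pos hκ hc0]
  nlinarith

end Approximation

/-! ### Passage to the limit and construction of the deflator. -/

section Deflator

variable {Ω : Type*} {m : MeasurableSpace Ω} {P : Measure Ω} {T : ℝ}
  {ℱ : Filtration (Icc (0 : ℝ) T) m} {𝒳 : Set (StochProc T Ω)}

/-- Mixing with a small positive constant explains the conventions: `θ / θ` tends to one, and a
positive numerator over `θ` tends to infinity. -/
theorem tendsto_ofReal_extRatio {a b : ℝ} (ha : 0 ≤ a) (hb : 0 ≤ b) {θ : ℕ → ℝ}
    (hθ0 : ∀ k, 0 < θ k) (hθ : Tendsto θ atTop (𝓝 0)) :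
    Tendsto (fun k => ENNReal.ofReal (((1 - θ k) * b + θ k) / ((1 - θ k) * a + θ k))) atTop
      (𝓝 (extRatio b a)) := by
  have hn : ∀ c : ℝ, Tendsto (fun k => (1 - θ k) * c + θ k) atTop (𝓝 c) := fun c => by
    simpa using ((hθ.const_sub 1).mul_const c).add hθ
  unfold extRatio
  split_ifs with h1 h2
  · subst h1 h2
    refine tendsto_const_nhds.congr fun k => ?_
    simp [div_self (hθ0 k).ne']
  · subst h1
    have hb' : 0 < b := lt_of_le_of_ne hb (Ne.symm h2)
    refine ENNReal.tendsto_ofReal_atTop.comp ?_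
    simp only [mul_zero, zero_add]
    have hθ' : Tendsto θ atTop (𝓝[>] 0) :=
      tendsto_nhdsWithin_iff.2 ⟨hθ, Eventually.of_forall hθ0⟩
    simp only [div_eq_mul_inv]
    exact (hn b).pos_mul_atTop hb' hθ'.inv_tendsto_nhdsGT_zero
  · exact (ENNReal.continuous_ofReal.tendsto _).comp ((hn b).div (hn a) h1)

theorem tendsto_approxRatio {ε ρ g : ℕ → ℝ} {ρ' g' : ℝ} (hε : Tendsto ε atTop (𝓝 0))
    (hρ : Tendsto ρ atTop (𝓝 ρ')) (hg : Tendsto g atTop (𝓝 g')) (hg' : 0 < g') :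
    Tendsto (fun k => approxRatio (ε k) (ρ k * g k) (g k)) atTop (𝓝 ρ') := by
  have h := (hρ.mul hg).div ((((hε.const_sub 1).mul hg).add
    (hε.mul ((hρ.mul hg).add_const 1))).mul ((hε.mul hg).const_add 1)) (by simpa using hg'.ne')
  simpa [approxRatio, hg'.ne', Pi.div_def] using h

/-- The precision `1 / (n + 2)` used along the approximating sequence. -/
noncomputable def precision (n : ℕ) : ℝ := 1 / ((n : ℝ) + 2)

theorem precision_pos (n : ℕ) : 0 < precision n := by unfold precision; positivity

theorem precision_le_half (n : ℕ) : precision n ≤ 1 / 2 :=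
  one_div_le_one_div_of_le (by norm_num) (by linarith [(Nat.cast_nonneg n : (0 : ℝ) ≤ n)])

theorem tendsto_precision : Tendsto precision atTop (𝓝 0) :=
  tendsto_const_nhds.div_atTop (tendsto_natCast_atTop_atTop.atTop_add tendsto_const_nhds)

/-- `X n` are approximate numéraires of increasing precision whose logarithms converge in
probability to `L`. -/
structure IsNumeraireLimit (P : Measure Ω) (𝒳 : Set (StochProc T Ω)) (b : Icc (0 : ℝ) T)
    (Xbar : StochProc T Ω) (X : ℕ → StochProc T Ω) (L : StochProc T Ω) : Prop where
  approx : ∀ n, IsApproxNumeraire P 𝒳 b Xbar (precision n ^ 2) (X n)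
  measurable : ∀ t, Measurable (L t)
  tendsto : ∀ t, TendstoInMeasure P (fun n ω => Real.log (X n t ω)) atTop (L t)

variable [IsProbabilityMeasure P]

theorem exists_isNumeraireLimit {b : Icc (0 : ℝ) T} (hb : IsTop b) {Xbar : StochProc T Ω}
    (hn : ∀ X ∈ 𝒳, IsNonneg P X) (hcad : ∀ X ∈ 𝒳, IsCadInProb P X) (hc : IsConvex P 𝒳)
    (hd : HasSwitching P ℱ 𝒳) (hXbar : Xbar ∈ 𝒳) (hpos : IsStrictlyPos P Xbar)
    (hbd : IsBoundedInProb P (valuesAt 𝒳 b)) :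
    ∃ X L, IsNumeraireLimit P 𝒳 b Xbar X L ∧ IsCadInProb P L := by
  have hε : ∀ n, precision n ^ 2 ≤ 1 / 2 := fun n => by
    nlinarith [precision_pos n, precision_le_half n]
  choose X hX using fun n : ℕ =>
    exists_isApproxNumeraire hn hc hXbar hpos b (pow_pos (precision_pos n) 2) (hε n)
  have hC : ∀ κ > 0, ∃ N, ∀ i ≥ N, ∀ j ≥ N, ∀ t,
      P {ω | κ ≤ |Real.log (X i t ω) - Real.log (X j t ω)|} ≤ ENNReal.ofReal κ := by
    intro κ hκ
    obtain ⟨δ₀, hδ₀, h⟩ := exists_measureReal_log_sub_ge_le hb hd hXbar hpos hbd hκ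
    obtain ⟨N, hN⟩ := eventually_atTop.1 (tendsto_precision.eventually_le_const hδ₀)
    refine ⟨N, fun i hi j hj t => (ENNReal.le_ofReal_iff_toReal_le (measure_ne_top _ _) hκ.le).2 ?_⟩
    exact h _ _ (precision_pos i) (hN i hi) (precision_pos j) (hN j hj) _ _ (hX i) (hX j) t
  choose L hLm hL using fun t => exists_tendstoInMeasure_of_cauchy (P := P) (l := atTop)
    (f := fun n ω => Real.log (X n t ω)) (fun n => ((hX n).2.1 t).1.log.aemeasurable) (by
      intro κ hκ
      obtain ⟨N, hN⟩ := hC κ hκ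
      rw [prod_atTop_atTop_eq]
      filter_upwards [eventually_ge_atTop (N, N)] with p hp
      exact hN p.1 hp.1 p.2 hp.2 t)
  refine ⟨X, L, ⟨hX, hLm, hL⟩, fun t => ?_⟩
  have hU : ∀ κ > 0, ∃ N, ∀ s, P {ω | 2 * κ ≤ |Real.log (X N s ω) - L s ω|} ≤ ENNReal.ofReal κ := by
    intro κ hκ
    obtain ⟨N, hN⟩ := hC κ hκ
    refine ⟨N, fun s => measure_le_of_tendstoInMeasure hκ (hL s) ?_⟩
    filter_upwards [eventually_ge_atTop N] with j hj
    exact hN N le_rfl j hj s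
  have hlog : ∀ n, TendstoInMeasure P (fun s ω => Real.log (X n s ω)) (𝓝[>] t)
      (fun ω => Real.log (X n t ω)) := fun n =>
    TendstoInMeasure.map₁ Real.measurable_log (fun s => ((hX n).2.1 s).1.aemeasurable)
      (hcad _ (hX n).1 t) (((hX n).2.1 t).2.mono fun ω h => Real.continuousAt_log h.ne')
  rw [tendstoInMeasure_iff_norm]
  intro ε hε
  rw [ENNReal.tendsto_nhds_zero]
  intro η hη
  -- The distance splits as `2κ + 2κ + κ` (two approximations of `L` and one right-continuity
  -- estimate); each exceptional event has probability at most `κ`.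
  obtain ⟨κ, hκ0, hκε, hκη⟩ : ∃ κ : ℝ, 0 < κ ∧ 5 * κ ≤ ε ∧ ENNReal.ofReal (3 * κ) ≤ η := by
    rcases eq_or_ne η ⊤ with rfl | hη'
    · exact ⟨ε / 5, by positivity, by linarith, le_top⟩
    · have := ENNReal.toReal_pos hη.ne' hη'
      refine ⟨min (ε / 5) (η.toReal / 3), by positivity, ?_, ?_⟩
      · linarith [min_le_left (ε / 5) (η.toReal / 3)]
      · refine ENNReal.ofReal_le_of_le_toReal ?_
        linarith [min_le_right (ε / 5) (η.toReal / 3)]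
  obtain ⟨N, hN⟩ := hU κ hκ0
  have h1 := (tendstoInMeasure_iff_norm.1 (hlog N)) κ hκ0
  filter_upwards [h1.eventually_le_const (ENNReal.ofReal_pos.2 hκ0)] with s hs
  calc P {ω | ε ≤ ‖L s ω - L t ω‖}
      ≤ P (({ω | 2 * κ ≤ |Real.log (X N s ω) - L s ω|} ∪
          {ω | 2 * κ ≤ |Real.log (X N t ω) - L t ω|}) ∪
          {ω | κ ≤ ‖Real.log (X N s ω) - Real.log (X N t ω)‖}) := by
        refine measure_mono fun ω (hω : ε ≤ ‖L s ω - L t ω‖) => ?_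
        by_contra hcon
        simp only [mem_union, not_or] at hcon
        obtain ⟨⟨c1, c2⟩, c3⟩ := hcon
        replace c1 : |Real.log (X N s ω) - L s ω| < 2 * κ := lt_of_not_ge c1
        replace c2 : |Real.log (X N t ω) - L t ω| < 2 * κ := lt_of_not_ge c2
        replace c3 : ‖Real.log (X N s ω) - Real.log (X N t ω)‖ < κ := lt_of_not_ge c3
        rw [Real.norm_eq_abs] at hω c3
        rw [abs_lt] at c1 c2 c3
        have : |L s ω - L t ω| < 5 * κ := by
          rw [abs_lt]
          constructor <;> linarith
        linarith
    _ ≤ (ENNReal.ofReal κ + ENNReal.ofReal κ) + ENNReal.ofReal κ :=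
        (measure_union_le _ _).trans (add_le_add ((measure_union_le _ _).trans
          (add_le_add (hN s) (hN t))) hs)
    _ = ENNReal.ofReal (3 * κ) := by
        rw [← ENNReal.ofReal_add hκ0.le hκ0.le, ← ENNReal.ofReal_add (by positivity) hκ0.le]
        ring_nf
    _ ≤ η := hκη

/-- The supermartingale property of an approximate numéraire with respect to a strictly positive
process in the class. -/
theorem IsApproxNumeraire.lintegral_le {b : Icc (0 : ℝ) T} (hb : IsTop b)
    {Xbar X W : StochProc T Ω} {ε : ℝ} (hε0 : 0 < ε) (hε : ε ≤ 1 / 2)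
    (hn : ∀ X ∈ 𝒳, IsNonneg P X) (hd : HasSwitching P ℱ 𝒳)
    (hpos : IsStrictlyPos P Xbar) (hX : IsApproxNumeraire P 𝒳 b Xbar ε X)
    (hW : MemUpToModification P 𝒳 W) (hW0 : IsStrictlyPos P W) {s t : Icc (0 : ℝ) T}
    (hst : s ≤ t) {A : Set Ω} (hA : MeasurableSet[ℱ s] A) :
    ∫⁻ ω, ENNReal.ofReal (approxRatio ε
      ((A.indicator (fun ω => X s ω / W s ω * W t ω / X t ω - 1) ω + 1) * (X b ω / Xbar b ω))
      (X b ω / Xbar b ω)) ∂P ≤ ENNReal.ofReal (1 + 4 * ε) := by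
  obtain ⟨W', hW', hWW⟩ := hW
  have hA' : MeasurableSet A := ℱ.le s A hA
  have hW'0 := hW0.of_memUpToModification hn hW' hWW
  -- On `A` the competitor follows `W` between `s` and `t`, and otherwise it follows `X`. The second
  -- switch returns to `X` everywhere at `t`, so relative to `X` its terminal value records exactly
  -- the gain over `[s, t]`.
  obtain ⟨V₁, hV₁, hVe₁⟩ := hd s A hA X hX.1 W' hW' hW'0
  have hV₁0 : IsStrictlyPos P V₁ :=
    (hX.2.1.switch hA' hW'0).of_memUpToModification hn hV₁ hVe₁
  have hV0 : IsStrictlyPos P (switch t univ V₁ X) := hV₁0.switch MeasurableSet.univ hX.2.1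
  have h1 := hX.2.2 _ (hd t univ MeasurableSet.univ V₁ hV₁ X hX.1 hX.2.1) hV0
  obtain ⟨gm, g0⟩ := hX.2.1.div_pos hpos b b
  obtain ⟨fm, f0⟩ := hV0.div_pos hpos b b
  have hi := integrable_approxRatio hε0 hε fm gm (f0.mono fun _ h => h.le)
    (g0.mono fun _ h => h.le)
  have hnn : 0 ≤ᵐ[P] fun ω =>
      approxRatio ε (switch t univ V₁ X b ω / Xbar b ω) (X b ω / Xbar b ω) := by
    filter_upwards [f0, g0] with ω h1 h2
    exact approxRatio_nonneg hε0 hε h1.le h2.le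
  refine le_trans (le_of_eq ?_) (ENNReal.ofReal_le_ofReal h1)
  rw [ofReal_integral_eq_lintegral_ofReal hi hnn]
  refine lintegral_congr_ae ?_
  filter_upwards [hVe₁ t, hWW s, hWW t, (hX.2.1 t).2] with ω e1 e2 e3 p1
  have e : switch t univ V₁ X b ω / Xbar b ω =
      (A.indicator (fun ω => X s ω / W s ω * W t ω / X t ω - 1) ω + 1) * (X b ω / Xbar b ω) := by
    rw [switch_apply_of_mem (hb t) (mem_univ ω), e1]
    by_cases hω : ω ∈ A
    · rw [switch_apply_of_mem hst hω, indicator_of_mem hω, e2, e3]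
      ring
    · rw [switch_apply_of_notMem hω, indicator_of_notMem hω, div_self p1.ne']
      ring
  rw [e]

/-- Use `lintegral_le` for `X n` against the mixture of `U` and `X n`, then Fatou. The mixture is
needed because switching requires a strictly positive target, and in units of `X n` its second
component is the constant `θ`. -/
theorem IsNumeraireLimit.setLIntegral_le {b : Icc (0 : ℝ) T} (hb : IsTop b) {Xbar : StochProc T Ω}
    (hn : ∀ X ∈ 𝒳, IsNonneg P X) (hc : IsConvex P 𝒳) (hd : HasSwitching P ℱ 𝒳)
    (hpos : IsStrictlyPos P Xbar) {X : ℕ → StochProc T Ω} {L : StochProc T Ω}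
    (h : IsNumeraireLimit P 𝒳 b Xbar X L) {U : StochProc T Ω} (hU : U ∈ 𝒳) {θ : ℝ} (hθ0 : 0 < θ)
    (hθ : θ ≤ 1) {s t : Icc (0 : ℝ) T} (hst : s ≤ t) {A : Set Ω} (hA : MeasurableSet[ℱ s] A) :
    ∫⁻ ω in A, ENNReal.ofReal (((1 - θ) * (Real.exp (-L t ω) * U t ω) + θ) /
      ((1 - θ) * (Real.exp (-L s ω) * U s ω) + θ)) ∂P ≤ P A := by
  have hA' : MeasurableSet A := ℱ.le s A hA
  have hε : ∀ n, precision n ^ 2 ≤ 1 / 2 := fun n => by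
    nlinarith [precision_pos n, precision_le_half n]
  set W : ℕ → StochProc T Ω := fun n t ω => (1 - θ) * U t ω + θ * X n t ω with hWdef
  have hW0 : ∀ n, IsStrictlyPos P (W n) := fun n =>
    IsStrictlyPos.convexComb (hn U hU) (h.approx n).2.1 hθ0 hθ
  have hle := fun n => (h.approx n).lintegral_le hb (pow_pos (precision_pos n) 2) (hε n) hn hd hpos
    (hc U hU (X n) (h.approx n).1 θ ⟨hθ0.le, hθ⟩) (hW0 n) hst hA
  obtain ⟨m₁, hm₁, hlim₁⟩ := exists_common_subseq (h.tendsto s) (h.tendsto t)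
  obtain ⟨m₂, hm₂, hlim₂⟩ := ((h.tendsto b).comp hm₁).exists_seq_tendsto_ae
  set k : ℕ → ℕ := m₁ ∘ m₂ with hk
  have hkt : Tendsto k atTop atTop := hm₁.comp hm₂.tendsto_atTop
  set r : Ω → ℝ := fun ω => ((1 - θ) * (Real.exp (-L t ω) * U t ω) + θ) /
      ((1 - θ) * (Real.exp (-L s ω) * U s ω) + θ) with hr
  have hεk : Tendsto (fun i => precision (k i) ^ 2) atTop (𝓝 0) := by
    simpa using (tendsto_precision.comp hkt).pow 2
  have hrm : Measurable r :=
    ((((h.measurable t).neg.exp.mul (hn U hU t).1).const_mul _).add_const _).div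
    ((((h.measurable s).neg.exp.mul (hn U hU s).1).const_mul _).add_const _)
  have hlim : ∀ᵐ ω ∂P, Tendsto (fun i => ENNReal.ofReal (approxRatio (precision (k i) ^ 2)
      ((A.indicator (fun ω => X (k i) s ω / W (k i) s ω * W (k i) t ω / X (k i) t ω - 1) ω + 1) *
        (X (k i) b ω / Xbar b ω)) (X (k i) b ω / Xbar b ω))) atTop
      (𝓝 (ENNReal.ofReal (A.indicator (fun ω => r ω - 1) ω + 1))) := by
    have hXpos : ∀ᵐ ω ∂P, ∀ n, 0 < X n s ω ∧ 0 < X n t ω ∧ 0 < X n b ω :=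
      ae_all_iff.2 fun n => by
        filter_upwards [((h.approx n).2.1 s).2, ((h.approx n).2.1 t).2, ((h.approx n).2.1 b).2]
          with ω h1 h2 h3 using ⟨h1, h2, h3⟩
    filter_upwards [hlim₁, hlim₂, hXpos, (hpos b).2, (hn U hU s).2] with ω l1 l2 hp pb us
    have aux : ∀ u : Icc (0 : ℝ) T, (∀ n, 0 < X n u ω) →
        Tendsto (fun i => Real.log (X (k i) u ω)) atTop (𝓝 (L u ω)) →
        Tendsto (fun i => X (k i) u ω) atTop (𝓝 (Real.exp (L u ω))) := fun u hu hl =>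
      ((Real.continuous_exp.tendsto _).comp hl).congr fun i => Real.exp_log (hu _)
    have ts := aux s (fun n => (hp n).1) (l1.1.comp hm₂.tendsto_atTop)
    have tt := aux t (fun n => (hp n).2.1) (l1.2.comp hm₂.tendsto_atTop)
    have tb := aux b (fun n => (hp n).2.2) l2
    have tWs : Tendsto (fun i => W (k i) s ω) atTop
        (𝓝 ((1 - θ) * U s ω + θ * Real.exp (L s ω))) := (ts.const_mul θ).const_add _
    have tWt : Tendsto (fun i => W (k i) t ω) atTop
        (𝓝 ((1 - θ) * U t ω + θ * Real.exp (L t ω))) := (tt.const_mul θ).const_add _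
    have hpos' : 0 < (1 - θ) * U s ω + θ * Real.exp (L s ω) :=
      add_pos_of_nonneg_of_pos (mul_nonneg (by linarith) us) (by positivity)
    have hρ : Tendsto (fun i => A.indicator (fun ω => X (k i) s ω / W (k i) s ω * W (k i) t ω /
        X (k i) t ω - 1) ω + 1) atTop (𝓝 (A.indicator (fun ω => r ω - 1) ω + 1)) := by
      by_cases hω : ω ∈ A
      · simp only [indicator_of_mem hω, sub_add_cancel]
        have := ((ts.div tWs hpos'.ne').mul tWt).div tt (Real.exp_pos _).ne'
        convert! this using 2
        simp only [hr, Real.exp_neg]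
        have e1 := Real.exp_pos (L s ω)
        have e2 := Real.exp_pos (L t ω)
        have e3 : (1 - θ) * ((Real.exp (L s ω))⁻¹ * U s ω) + θ =
          ((1 - θ) * U s ω + θ * Real.exp (L s ω)) / Real.exp (L s ω) := by field_simp
        have e4 : (1 - θ) * ((Real.exp (L t ω))⁻¹ * U t ω) + θ =
          ((1 - θ) * U t ω + θ * Real.exp (L t ω)) / Real.exp (L t ω) := by field_simp
        rw [e3, e4]
        have := hpos'.ne'
        field_simp
      · simp only [indicator_of_notMem hω]
        exact tendsto_const_nhds
    exact (ENNReal.continuous_ofReal.tendsto _).comp (tendsto_approxRatio hεk hρ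
      (tb.div_const (Xbar b ω)) (div_pos (Real.exp_pos _) pb))
  have hfm : ∀ i, Measurable fun ω => ENNReal.ofReal (approxRatio (precision (k i) ^ 2)
      ((A.indicator (fun ω => X (k i) s ω / W (k i) s ω * W (k i) t ω / X (k i) t ω - 1) ω + 1) *
        (X (k i) b ω / Xbar b ω)) (X (k i) b ω / Xbar b ω)) := by
    intro i
    have hX := (h.approx (k i)).2.1
    have gm := (hX.div_pos hpos b b).1
    refine (measurable_approxRatio (Measurable.mul (Measurable.add_const
      (Measurable.indicator ?_ hA') _) gm) gm).ennreal_ofReal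
    exact (((((hX s).1.div (hW0 (k i) s).1).mul (hW0 (k i) t).1).div (hX t).1).sub_const 1)
  have hfat : ∫⁻ ω, ENNReal.ofReal (A.indicator (fun ω => r ω - 1) ω + 1) ∂P ≤ 1 := by
    rw [lintegral_congr_ae (hlim.mono fun ω hω => hω.liminf_eq.symm)]
    refine (lintegral_liminf_le hfm).trans ?_
    refine (liminf_le_liminf (Eventually.of_forall fun i => hle (k i))).trans (le_of_eq ?_)
    have : Tendsto (fun i => ENNReal.ofReal (1 + 4 * precision (k i) ^ 2)) atTop (𝓝 1) := by
      have h2 := (ENNReal.continuous_ofReal.tendsto _).comp ((hεk.const_mul 4).const_add 1)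
      simpa [Function.comp_def] using h2
    exact this.liminf_eq
  -- Off `A` the integrand is one, so that part contributes exactly `P Aᶜ` and cancels.
  rw [← lintegral_add_compl _ hA'] at hfat
  have h1 : ∫⁻ ω in A, ENNReal.ofReal (A.indicator (fun ω => r ω - 1) ω + 1) ∂P =
      ∫⁻ ω in A, ENNReal.ofReal (r ω) ∂P :=
    setLIntegral_congr_fun hA' fun ω hω => by simp only [indicator_of_mem hω, sub_add_cancel]
  have h2 : ∫⁻ ω in Aᶜ, ENNReal.ofReal (A.indicator (fun ω => r ω - 1) ω + 1) ∂P = P Aᶜ := by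
    rw [setLIntegral_congr_fun (g := fun _ => 1) hA'.compl fun ω hω => by
      simp only [indicator_of_notMem hω, zero_add, ENNReal.ofReal_one]]
    simp
  rw [h1, h2, ← prob_add_prob_compl (μ := P) hA'] at hfat
  exact (ENNReal.add_le_add_iff_right (measure_ne_top _ _)).1 hfat

/-- Let the mixing weight `θ` tend to zero; a second use of Fatou handles processes that may vanish.
-/
theorem IsNumeraireLimit.isDeflator {b : Icc (0 : ℝ) T} (hb : IsTop b) {Xbar : StochProc T Ω}
    (hn : ∀ X ∈ 𝒳, IsNonneg P X) (hc : IsConvex P 𝒳) (hd : HasSwitching P ℱ 𝒳)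
    (hpos : IsStrictlyPos P Xbar) {X : ℕ → StochProc T Ω} {L : StochProc T Ω}
    (h : IsNumeraireLimit P 𝒳 b Xbar X L) :
    IsDeflator P ℱ 𝒳 (fun t ω => Real.exp (-L t ω)) := by
  have hYm : ∀ t, Measurable fun ω => Real.exp (-L t ω) := fun t => (h.measurable t).neg.exp
  refine ⟨fun t => ⟨hYm t, ae_of_all _ fun ω => Real.exp_pos _⟩, fun U hU => ?_⟩
  have hnn : IsNonneg P (fun t ω => Real.exp (-L t ω) * U t ω) := fun t =>
    ⟨(hYm t).mul (hn U hU t).1, (hn U hU t).2.mono fun ω hω => mul_nonneg (Real.exp_pos _).le hω⟩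
  refine ⟨hnn, fun s t hst => (condLExp_le_one_iff (ℱ.le s)).2 fun A hA => ?_⟩
  have hlim : ∀ᵐ ω ∂(P.restrict A), Tendsto (fun n => ENNReal.ofReal
      (((1 - precision n) * (Real.exp (-L t ω) * U t ω) + precision n) /
      ((1 - precision n) * (Real.exp (-L s ω) * U s ω) + precision n))) atTop
      (𝓝 (extRatio (Real.exp (-L t ω) * U t ω) (Real.exp (-L s ω) * U s ω))) := by
    filter_upwards [ae_restrict_of_ae (hnn s).2, ae_restrict_of_ae (hnn t).2] with ω h1 h2
    exact tendsto_ofReal_extRatio h1 h2 precision_pos tendsto_precision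
  rw [lintegral_congr_ae (hlim.mono fun ω hω => hω.liminf_eq.symm)]
  refine (lintegral_liminf_le fun n => ?_).trans ?_
  · exact (((((hnn t).1.const_mul _).add_const _).div
      (((hnn s).1.const_mul _).add_const _))).ennreal_ofReal
  · refine liminf_le_of_frequently_le' (Frequently.of_forall fun n => ?_)
    exact h.setLIntegral_le hb hn hc hd hpos hU (precision_pos n)
      ((precision_le_half n).trans (by norm_num)) hst hA

end Deflator

/-! ### Boundedness, closedness and regularity from deflators. -/

section Equivalence

variable {Ω : Type*} {m : MeasurableSpace Ω} {P : Measure Ω} {T : ℝ}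
  {ℱ : Filtration (Icc (0 : ℝ) T) m} {𝒳 : Set (StochProc T Ω)}

theorem extRatio_of_pos {a b : ℝ} (ha : 0 < a) : extRatio b a = ENNReal.ofReal (b / a) :=
  if_neg ha.ne'

theorem IsGenSupermartingale.congr {Z Z' : StochProc T Ω} (hZ : IsGenSupermartingale P ℱ Z)
    (hm : ∀ t, Measurable (Z' t)) (h : ∀ t, Z t =ᵐ[P] Z' t) : IsGenSupermartingale P ℱ Z' := by
  refine ⟨fun t => ⟨hm t, ?_⟩, fun s t hst => ?_⟩
  · filter_upwards [(hZ.1 t).2, h t] with ω h1 h2 using h2 ▸ h1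
  · have e : condLExp (ℱ s) P (fun ω => extRatio (Z t ω) (Z s ω)) =ᵐ[P]
        condLExp (ℱ s) P (fun ω => extRatio (Z' t ω) (Z' s ω)) := by
      refine condLExp_congr_ae ?_
      filter_upwards [h s, h t] with ω h1 h2
      rw [h1, h2]
    filter_upwards [e, hZ.2 s t hst] with ω h1 h2 using h1 ▸ h2

theorem IsStrictlyPos.mul {X X' : StochProc T Ω} (hX : IsStrictlyPos P X)
    (hX' : IsStrictlyPos P X') : IsStrictlyPos P (fun t ω => X t ω * X' t ω) :=
  fun t => ⟨(hX t).1.mul (hX' t).1, by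
    filter_upwards [(hX t).2, (hX' t).2] with ω h1 h2 using mul_pos h1 h2⟩

/-- The reciprocal of a numéraire is a deflator. -/
theorem IsNumeraire.isDeflator_inv {Xhat : StochProc T Ω} (h : IsNumeraire P ℱ 𝒳 Xhat) :
    IsDeflator P ℱ 𝒳 (fun t ω => (Xhat t ω)⁻¹) := by
  refine ⟨fun t => ⟨(h.2.1 t).1.inv, (h.2.1 t).2.mono fun ω hω => inv_pos.2 hω⟩, fun X hX => ?_⟩
  have e : (fun t ω => (Xhat t ω)⁻¹ * X t ω) = fun t ω => X t ω / Xhat t ω := by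
    ext t ω
    rw [div_eq_inv_mul]
  rw [e]
  exact h.2.2 X hX

theorem two_le_extRatio_one_add {z : ℝ} (hz : 0 ≤ z) :
    2 ≤ extRatio 1 z + ENNReal.ofReal z ∧ (2 = extRatio 1 z + ENNReal.ofReal z → z = 1) := by
  rcases hz.eq_or_lt with rfl | hz
  · simp [extRatio]
  · rw [extRatio_of_pos hz, ← ENNReal.ofReal_add (by positivity) hz.le, ← ENNReal.ofReal_ofNat 2]
    have e : 1 / z + z = 2 + (z - 1) ^ 2 / z := by field_simp; ring
    rw [e]
    refine ⟨ENNReal.ofReal_le_ofReal (by linarith [show 0 ≤ (z - 1) ^ 2 / z by positivity]),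
      fun h => ?_⟩
    rw [ENNReal.ofReal_eq_ofReal_iff (by norm_num) (by positivity)] at h
    have h' : (z - 1) ^ 2 / z = 0 := by linarith
    rw [div_eq_zero_iff, or_iff_left hz.ne'] at h'
    linarith [pow_eq_zero_iff (two_ne_zero) |>.1 h']

variable [IsProbabilityMeasure P]

theorem IsGenSupermartingale.lintegral_extRatio_le {Z : StochProc T Ω}
    (hZ : IsGenSupermartingale P ℱ Z) {s t : Icc (0 : ℝ) T} (hst : s ≤ t) :
    ∫⁻ ω, extRatio (Z t ω) (Z s ω) ∂P ≤ 1 := by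
  simpa using (condLExp_le_one_iff (ℱ.le s)).1 (hZ.2 s t hst) univ MeasurableSet.univ

theorem IsGenSupermartingale.hasRatioLeOne {Z : StochProc T Ω}
    (hZ : IsGenSupermartingale P ℱ Z) (hpos : IsStrictlyPos P Z) : HasRatioLeOne P Z :=
  fun s t hst => by
    refine (lintegral_congr_ae ?_).trans_le (hZ.lintegral_extRatio_le hst)
    filter_upwards [(hpos s).2] with ω h
    rw [extRatio_of_pos h]

/-- A deflator forces the terminal values to be bounded in probability. -/
theorem IsDeflator.isBoundedInProb {z b : Icc (0 : ℝ) T} (hzb : z ≤ b)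
    (hn : ∀ X ∈ 𝒳, IsNonneg P X) (hz : ∀ X ∈ 𝒳, ∀ᵐ ω ∂P, X z ω = 1) {Y : StochProc T Ω} (hY : IsDeflator P ℱ 𝒳 Y) :
    IsBoundedInProb P (valuesAt 𝒳 b) := by
  refine ENNReal.tendsto_nhds_zero.2 fun η hη => ?_
  obtain ⟨r, hr0, hr⟩ : ∃ r : ℝ, 0 < r ∧ ENNReal.ofReal (r + r) ≤ η := by
    rcases eq_or_ne η ⊤ with rfl | hη'
    · exact ⟨1, one_pos, le_top⟩
    · exact ⟨η.toReal / 2, half_pos (ENNReal.toReal_pos hη.ne' hη'), by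
        rw [add_halves, ENNReal.ofReal_toReal hη']⟩
  obtain ⟨hm, h0⟩ := hY.1.div_pos hY.1 b z
  obtain ⟨c, hc, hPc⟩ := exists_measureReal_lt_le hm h0 hr0
  -- At this level the Markov bound `1 / (c * ℓ)` is at most `r`.
  filter_upwards [eventually_ge_atTop (1 / (r * c))] with ℓ hℓ
  have hℓ0 : 0 < ℓ := lt_of_lt_of_le (by positivity) hℓ
  refine iSup₂_le fun f hf => ?_
  obtain ⟨X, hX, rfl⟩ := hf
  have hZ := hY.2 X hX
  have h1 : ∫⁻ ω, ENNReal.ofReal (Y b ω / Y z ω * X b ω) ∂P ≤ 1 := by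
    refine (lintegral_congr_ae ?_).trans_le (hZ.lintegral_extRatio_le hzb)
    filter_upwards [hz X hX, (hY.1 z).2] with ω e1 e2
    simp only [e1, mul_one]
    rw [extRatio_of_pos e2]
    ring_nf
  have h2 : P {ω | ENNReal.ofReal (c * ℓ) ≤ ENNReal.ofReal (Y b ω / Y z ω * X b ω)} ≤
      ENNReal.ofReal r := by
    refine (meas_ge_le_lintegral_div (hm.mul (hn X hX b).1).ennreal_ofReal.aemeasurable ?_
      ENNReal.ofReal_ne_top).trans ?_
    · simpa using mul_pos hc hℓ0
    · refine (ENNReal.div_le_div_right h1 _).trans ?_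
      rw [← ENNReal.ofReal_one, ← ENNReal.ofReal_div_of_pos (mul_pos hc hℓ0)]
      refine ENNReal.ofReal_le_ofReal ?_
      rw [div_le_iff₀ (by positivity)] at hℓ ⊢
      linarith
  have h3 : P {ω | Y b ω / Y z ω < c} ≤ ENNReal.ofReal r :=
    (ENNReal.le_ofReal_iff_toReal_le (measure_ne_top _ _) hr0.le).2 hPc
  calc P {ω | ℓ < X b ω}
      ≤ P ({ω | Y b ω / Y z ω < c} ∪
          {ω | ENNReal.ofReal (c * ℓ) ≤ ENNReal.ofReal (Y b ω / Y z ω * X b ω)}) := by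
        refine measure_mono fun ω (hω : ℓ < X b ω) => ?_
        by_cases hcω : Y b ω / Y z ω < c
        · exact Or.inl hcω
        · refine Or.inr (ENNReal.ofReal_le_ofReal ?_)
          exact mul_le_mul (not_lt.1 hcω) hω.le hℓ0.le (hc.le.trans (not_lt.1 hcω))
    _ ≤ ENNReal.ofReal r + ENNReal.ofReal r := (measure_union_le _ _).trans (add_le_add h3 h2)
    _ = ENNReal.ofReal (r + r) := (ENNReal.ofReal_add hr0.le hr0.le).symm
    _ ≤ η := hr

/-- If a generalized supermartingale starts and ends at one, it is constant. -/
theorem IsGenSupermartingale.ae_eq_one {Z : StochProc T Ω} (hZ : IsGenSupermartingale P ℱ Z)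
    {z b : Icc (0 : ℝ) T} (hz : ∀ᵐ ω ∂P, Z z ω = 1) (hb : ∀ᵐ ω ∂P, Z b ω = 1)
    {t : Icc (0 : ℝ) T} (hzt : z ≤ t) (htb : t ≤ b) : ∀ᵐ ω ∂P, Z t ω = 1 := by
  have hm : Measurable fun ω => ENNReal.ofReal (Z t ω) := (hZ.1 t).1.ennreal_ofReal
  have hm' : Measurable fun ω => extRatio 1 (Z t ω) := by
    unfold extRatio
    exact Measurable.ite ((hZ.1 t).1 (measurableSet_singleton 0)) (by fun_prop)
      ((hZ.1 t).1.const_div 1).ennreal_ofReal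
  have h1 : ∫⁻ ω, ENNReal.ofReal (Z t ω) ∂P ≤ 1 := by
    refine (lintegral_congr_ae ?_).trans_le (hZ.lintegral_extRatio_le hzt)
    filter_upwards [hz] with ω hω
    rw [hω, extRatio_of_pos one_pos, div_one]
  have h2 : ∫⁻ ω, extRatio 1 (Z t ω) ∂P ≤ 1 := by
    refine (lintegral_congr_ae ?_).trans_le (hZ.lintegral_extRatio_le htb)
    filter_upwards [hb] with ω hω
    rw [hω]
  have h3 : (fun _ => 2) =ᵐ[P] fun ω => extRatio 1 (Z t ω) + ENNReal.ofReal (Z t ω) := by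
    refine ae_eq_of_ae_le_of_lintegral_le
      ((hZ.1 t).2.mono fun ω hω => (two_le_extRatio_one_add hω).1) (by simp)
      (hm'.add hm).aemeasurable ?_
    rw [lintegral_add_left hm']
    simpa [one_add_one_eq_two] using add_le_add h2 h1
  filter_upwards [h3, (hZ.1 t).2] with ω h4 h5 using (two_le_extRatio_one_add h5).2 h4

/-- If the terminal values are closed in probability, the limit of approximate numéraires is a
numéraire. -/
theorem IsNumeraireLimit.exists_isNumeraire {z b : Icc (0 : ℝ) T} (hzb : IsBot z) (hb : IsTop b)
    (hn : ∀ X ∈ 𝒳, IsNonneg P X) (hz : ∀ X ∈ 𝒳, ∀ᵐ ω ∂P, X z ω = 1) {Xbar : StochProc T Ω}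
    {X : ℕ → StochProc T Ω} {L : StochProc T Ω} (h : IsNumeraireLimit P 𝒳 b Xbar X L)
    (hdef : IsDeflator P ℱ 𝒳 (fun t ω => Real.exp (-L t ω)))
    (hcl : IsClosedInProb P (valuesAt 𝒳 b)) : ∃ Xhat, IsNumeraire P ℱ 𝒳 Xhat := by
  have hexp : TendstoInMeasure P (fun n => X n b) atTop (fun ω => Real.exp (L b ω)) := by
    refine (TendstoInMeasure.map₁ Real.measurable_exp
      (fun n => ((h.approx n).2.1 b).1.log.aemeasurable) (h.tendsto b)
      (ae_of_all _ fun ω => Real.continuous_exp.continuousAt)).congr_left fun n => ?_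
    filter_upwards [((h.approx n).2.1 b).2] with ω hω using Real.exp_log hω
  obtain ⟨_, ⟨U, hU, rfl⟩, hUe⟩ := hcl (fun n => X n b) (fun n => ⟨X n, (h.approx n).1, rfl⟩) _
    (h.measurable b).exp hexp
  have hLz : L z =ᵐ[P] fun _ => 0 := by
    refine tendstoInMeasure_ae_unique (h.tendsto z)
      ((tendstoInMeasure_of_tendsto_ae (f := fun _ _ => (0 : ℝ)) (g := fun _ => 0)
        (fun n => aestronglyMeasurable_const)
        (ae_of_all _ fun ω => tendsto_const_nhds)).congr_left fun n => ?_)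
    filter_upwards [hz _ (h.approx n).1] with ω hω
    rw [hω, Real.log_one]
  have hZ := hdef.2 U hU
  -- Closedness identifies only the terminal value; that `exp (-L) * U` starts and ends at one
  -- propagates the identity to all intermediate times.
  have h1 : ∀ t, ∀ᵐ ω ∂P, U t ω = Real.exp (L t ω) := fun t => by
    have := hZ.ae_eq_one (z := z) (b := b) (by
      filter_upwards [hLz, hz U hU] with ω e1 e2
      rw [e1, e2, neg_zero, Real.exp_zero, one_mul]) (by
      filter_upwards [hUe] with ω e1
      replace e1 : U b ω = Real.exp (L b ω) := e1
      rw [e1, ← Real.exp_add, neg_add_cancel, Real.exp_zero]) (hzb t) (hb t)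
    filter_upwards [this] with ω hω
    rwa [Real.exp_neg, inv_mul_eq_one₀ (Real.exp_pos _).ne', eq_comm] at hω
  refine ⟨U, hU, fun t => ⟨(hn U hU t).1, (h1 t).mono fun ω hω => hω ▸ Real.exp_pos _⟩, fun V hV => ?_⟩
  refine (hdef.2 V hV).congr (fun t => (hn V hV t).1.div (hn U hU t).1) fun t => ?_
  filter_upwards [h1 t] with ω hω
  rw [hω, Real.exp_neg, inv_mul_eq_div]

/-- The product has a positive left limit by the oscillation bound, so dividing by the positive left
limit of `V` gives that of `Y`. The roles are symmetric, which lets regularity pass both to and from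
a deflator. -/
theorem HasPosLeftLimits.of_mul {V Y : StochProc T Ω} (hV : IsStrictlyPos P V)
    (hVl : HasPosLeftLimits P V) (hY : IsStrictlyPos P Y)
    (hr : HasRatioLeOne P (fun t ω => Y t ω * V t ω)) : HasPosLeftLimits P Y := by
  intro u hu
  obtain ⟨M, hM, hlim⟩ := exists_log_leftLimit (hY.mul hV) hr hu
  obtain ⟨K, hK, hK0, hlim'⟩ := hVl u hu
  have hdiv : Measurable fun p : ℝ × ℝ => Real.exp p.1 / p.2 := by fun_prop
  refine ⟨fun ω => Real.exp (M ω) / K ω, hM.exp.div hK,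
    hK0.mono fun ω h => div_pos (Real.exp_pos _) h, ?_⟩
  refine (TendstoInMeasure.map₂ (F := fun p => Real.exp p.1 / p.2) hdiv
    (fun t => ((hY.mul hV) t).1.log.aemeasurable) (fun t => (hV t).1.aemeasurable) hlim hlim'
    (hK0.mono fun ω h => ?_)).congr_left fun t => ?_
  · exact (Real.continuous_exp.continuousAt.comp continuousAt_fst).div continuousAt_snd h.ne'
  · filter_upwards [(hY t).2, (hV t).2] with ω h1 h2
    simp only [Real.exp_log (mul_pos h1 h2)]
    field_simp

/-- If some strictly positive process in the class has strictly positive left limits, then so does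
every deflator. -/
theorem IsDeflator.hasPosLeftLimits {Xbar Y : StochProc T Ω} (hY : IsDeflator P ℱ 𝒳 Y)
    (hXbar : Xbar ∈ 𝒳) (hpos : IsStrictlyPos P Xbar) (hl : HasPosLeftLimits P Xbar) :
    HasPosLeftLimits P Y :=
  HasPosLeftLimits.of_mul hpos hl hY.1 ((hY.2 Xbar hXbar).hasRatioLeOne (hY.1.mul hpos))

/-- If there is a deflator and some strictly positive process in the class has strictly positive
left limits, then every process in the class is càdlàg in probability. -/
theorem IsDeflator.isCadlagInProb {Xbar Y : StochProc T Ω} (hY : IsDeflator P ℱ 𝒳 Y)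
    (hn : ∀ X ∈ 𝒳, IsNonneg P X) (hcad : ∀ X ∈ 𝒳, IsCadInProb P X) (hc : IsConvex P 𝒳)
    (hXbar : Xbar ∈ 𝒳) (hpos : IsStrictlyPos P Xbar) (hl : HasPosLeftLimits P Xbar)
    {X : StochProc T Ω} (hX : X ∈ 𝒳) : IsCadlagInProb P X := by
  refine ⟨hcad X hX, fun u hu => ?_⟩
  have := nhdsLT_neBot_of_pos hu
  -- `X` may vanish, so its logarithm is unusable; averaging with `Xbar` restores positivity, and `X
  -- = 2 V - Xbar` recovers the left limit.
  obtain ⟨V, hV, hVe⟩ := hc X hX Xbar hXbar (1 / 2) ⟨by norm_num, by norm_num⟩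
  have hV0 : IsStrictlyPos P V := IsStrictlyPos.of_memUpToModification hn
    (IsStrictlyPos.convexComb (hn X hX) hpos (by norm_num) (by norm_num)) hV hVe
  have hVl : HasPosLeftLimits P V := by
    refine HasPosLeftLimits.of_mul hY.1 (hY.hasPosLeftLimits hXbar hpos hl) hV0 ?_
    simp_rw [mul_comm (V _ _)]
    exact (hY.2 V hV).hasRatioLeOne (hY.1.mul hV0)
  obtain ⟨K, hK, -, hKl⟩ := hVl u hu
  obtain ⟨M, hM, -, hMl⟩ := hl u hu
  have hF : Continuous fun p : ℝ × ℝ => 2 * p.1 - p.2 := by fun_prop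
  have hlim : TendstoInMeasure P X (𝓝[<] u) (fun ω => 2 * K ω - M ω) := by
    refine (TendstoInMeasure.map₂ hF.measurable (fun t => (hV0 t).1.aemeasurable)
      (fun t => (hpos t).1.aemeasurable) hKl hMl
      (ae_of_all _ fun ω => hF.continuousAt)).congr_left fun t => ?_
    filter_upwards [hVe t] with ω hω
    simp only [hω]
    ring
  refine ⟨_, (hK.const_mul 2).sub hM, ?_, hlim⟩
  obtain ⟨ns, -, hns⟩ := hlim.exists_seq_tendsto_ae'
  filter_upwards [hns, ae_all_iff.2 fun i => (hn X hX (ns i)).2] with ω h1 h2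
  exact ge_of_tendsto' h1 h2

end Equivalence

end LimitedInfo

/-! ### The equivalences, with and without left limits. -/

theorem mainTheorem1 {Ω : Type*} {m : MeasurableSpace Ω} (P : Measure Ω) [IsProbabilityMeasure P]
    [P.IsComplete] (T : ℝ) (hT : 0 ≤ T) (ℱ : Filtration (Icc (0 : ℝ) T) m)
    [ℱ.IsRightContinuous]
    (hnull : ∀ A : Set Ω, P A = 0 → MeasurableSet[ℱ ⟨0, le_rfl, hT⟩] A)
    (htriv : ∀ A : Set Ω, MeasurableSet[ℱ ⟨0, le_rfl, hT⟩] A → P A = 0 ∨ P A = 1)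
    (𝒳 : Set (LimitedInfo.StochProc T Ω))
    (ha : ∀ X ∈ 𝒳, LimitedInfo.IsNonneg P X ∧ LimitedInfo.IsCadInProb P X ∧
      ∀ᵐ ω ∂P, X ⟨0, le_rfl, hT⟩ ω = 1)
    (hb : ∃ Xbar ∈ 𝒳, LimitedInfo.IsStrictlyPos P Xbar)
    (hc : LimitedInfo.IsConvex P 𝒳)
    (hd : LimitedInfo.HasSwitching P ℱ 𝒳) :
    -- if some strictly positive element has strictly positive left limits in probability
    ((∃ Xbar ∈ 𝒳, LimitedInfo.IsStrictlyPos P Xbar ∧ LimitedInfo.HasPosLeftLimits P Xbar) →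
      (LimitedInfo.IsBoundedInProb P (LimitedInfo.valuesAt 𝒳 ⟨T, hT, le_rfl⟩) ↔
        ∃ Y, LimitedInfo.IsCadlagInProb P Y ∧ LimitedInfo.IsDeflator P ℱ 𝒳 Y) ∧
      ((LimitedInfo.IsBoundedInProb P (LimitedInfo.valuesAt 𝒳 ⟨T, hT, le_rfl⟩) ∨
          ∃ Y, LimitedInfo.IsCadlagInProb P Y ∧ LimitedInfo.IsDeflator P ℱ 𝒳 Y) →
        ∀ X ∈ 𝒳, LimitedInfo.IsCadlagInProb P X) ∧
      (LimitedInfo.IsClosedInProb P (LimitedInfo.valuesAt 𝒳 ⟨T, hT, le_rfl⟩) →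
        List.TFAE [
          LimitedInfo.IsBoundedInProb P (LimitedInfo.valuesAt 𝒳 ⟨T, hT, le_rfl⟩),
          ∃ Y, LimitedInfo.IsCadlagInProb P Y ∧ LimitedInfo.IsDeflator P ℱ 𝒳 Y,
          ∃ Xhat, LimitedInfo.IsNumeraire P ℱ 𝒳 Xhat])) ∧
    -- without that condition on left limits
    (LimitedInfo.IsBoundedInProb P (LimitedInfo.valuesAt 𝒳 ⟨T, hT, le_rfl⟩) ↔
      ∃ Y, LimitedInfo.IsCadInProb P Y ∧ LimitedInfo.IsDeflator P ℱ 𝒳 Y) ∧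
    (LimitedInfo.IsClosedInProb P (LimitedInfo.valuesAt 𝒳 ⟨T, hT, le_rfl⟩) →
      (LimitedInfo.IsBoundedInProb P (LimitedInfo.valuesAt 𝒳 ⟨T, hT, le_rfl⟩) ↔
        ∃ Xhat, LimitedInfo.IsNumeraire P ℱ 𝒳 Xhat)) := by
  set z : Icc (0 : ℝ) T := ⟨0, le_rfl, hT⟩
  set b : Icc (0 : ℝ) T := ⟨T, hT, le_rfl⟩
  have hbot : IsBot z := fun t => t.2.1
  have htop : IsTop b := fun t => t.2.2
  have hn : ∀ X ∈ 𝒳, LimitedInfo.IsNonneg P X := fun X hX => (ha X hX).1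
  have hcad : ∀ X ∈ 𝒳, LimitedInfo.IsCadInProb P X := fun X hX => (ha X hX).2.1
  have hz : ∀ X ∈ 𝒳, ∀ᵐ ω ∂P, X z ω = 1 := fun X hX => (ha X hX).2.2
  have hlimit : LimitedInfo.IsBoundedInProb P (LimitedInfo.valuesAt 𝒳 b) →
      ∃ Xbar X L, LimitedInfo.IsNumeraireLimit P 𝒳 b Xbar X L ∧ LimitedInfo.IsCadInProb P L ∧
        LimitedInfo.IsDeflator P ℱ 𝒳 (fun t ω => Real.exp (-L t ω)) := by
    intro hbd
    obtain ⟨Xbar, hXbar, hpos⟩ := hb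
    obtain ⟨X, L, h, hL⟩ :=
      LimitedInfo.exists_isNumeraireLimit htop hn hcad hc hd hXbar hpos hbd
    exact ⟨Xbar, X, L, h, hL, h.isDeflator htop hn hc hd hpos⟩
  have h12 : LimitedInfo.IsBoundedInProb P (LimitedInfo.valuesAt 𝒳 b) →
      ∃ Y, LimitedInfo.IsCadInProb P Y ∧ LimitedInfo.IsDeflator P ℱ 𝒳 Y := by
    intro hbd
    obtain ⟨Xbar, X, L, h, hL, hdef⟩ := hlimit hbd
    have hexp : Continuous fun x : ℝ => Real.exp (-x) := by fun_prop
    exact ⟨_, fun t => LimitedInfo.TendstoInMeasure.map₁ hexp.measurable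
      (fun s => (h.measurable s).aemeasurable) (hL t)
      (ae_of_all _ fun ω => hexp.continuousAt), hdef⟩
  have h21 : ∀ Y, LimitedInfo.IsDeflator P ℱ 𝒳 Y →
      LimitedInfo.IsBoundedInProb P (LimitedInfo.valuesAt 𝒳 b) := fun Y hY =>
    hY.isBoundedInProb (htop z) hn hz
  have h31 : (∃ Xhat, LimitedInfo.IsNumeraire P ℱ 𝒳 Xhat) →
      LimitedInfo.IsBoundedInProb P (LimitedInfo.valuesAt 𝒳 b) := fun ⟨Xhat, h⟩ =>
    h21 _ h.isDeflator_inv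
  have h13 : LimitedInfo.IsClosedInProb P (LimitedInfo.valuesAt 𝒳 b) →
      LimitedInfo.IsBoundedInProb P (LimitedInfo.valuesAt 𝒳 b) →
      ∃ Xhat, LimitedInfo.IsNumeraire P ℱ 𝒳 Xhat := by
    intro hcl hbd
    obtain ⟨Xbar, X, L, h, hL, hdef⟩ := hlimit hbd
    exact h.exists_isNumeraire hbot htop hn hz hdef hcl
  refine ⟨?_, ⟨h12, fun ⟨Y, _, hY⟩ => h21 Y hY⟩, fun hcl => ⟨h13 hcl, h31⟩⟩
  rintro ⟨Xbar, hXbar, hpos, hl⟩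
  have h12' : LimitedInfo.IsBoundedInProb P (LimitedInfo.valuesAt 𝒳 b) →
      ∃ Y, LimitedInfo.IsCadlagInProb P Y ∧ LimitedInfo.IsDeflator P ℱ 𝒳 Y := by
    intro hbd
    obtain ⟨Y, hYc, hY⟩ := h12 hbd
    refine ⟨Y, ⟨hYc, fun t ht => ?_⟩, hY⟩
    obtain ⟨L, hL, hL0, hlim⟩ := hY.hasPosLeftLimits hXbar hpos hl t ht
    exact ⟨L, hL, hL0.mono fun ω h => h.le, hlim⟩
  have h21' : (∃ Y, LimitedInfo.IsCadlagInProb P Y ∧ LimitedInfo.IsDeflator P ℱ 𝒳 Y) →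
      LimitedInfo.IsBoundedInProb P (LimitedInfo.valuesAt 𝒳 b) := fun ⟨Y, _, hY⟩ => h21 Y hY
  refine ⟨⟨h12', h21'⟩, fun h X hX => ?_, fun hcl => ?_⟩
  · obtain ⟨Y, -, hY⟩ := h12 (h.elim id h21')
    exact hY.isCadlagInProb hn hcad hc hXbar hpos hl hX
  · tfae_have 1 ↔ 2 := ⟨h12', h21'⟩
    tfae_have 1 ↔ 3 := ⟨h13 hcl, h31⟩
    tfae_finish
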